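/- For a matrix $\mathbf X\in\mathbb R^{d\times n}$ with $d\ge 1$, a number $\lambda\ge 0$ and an integer $0\le s\le n$, where either $\lambda>0$, or $\lambda=0$, $\operatorname{rank}\mathbf X=d$ and $s\ge d$, $\lambda$-regularized size-$s$ volume sampling from $\mathbf X$ is the law of the random set $S\subseteq\{1,\dots,n\}$ with $|S|=s$ obtained as follows: start with $S=\{1,\dots,n\}$ and, while $|S|>s$, remove from $S$ a random element $i\in S$, drawn with conditional probability $$P(i\mid S)\ \propto\ \frac{\det(\mathbf X_{S\setminus\{i\}}\mathbf X_{S\setminus\{i\}}^\top+\lambda\mathbf I)}{\det(\mathbf X_S\mathbf X_S^\top+\lambda\mathbf I)},$$ where $\mathbf X_S$ consists of the columns of $\mathbf X$ with index in $S$. Consider randomized real-RAM programs: one step is one arithmetic operation ($+,-,\times,/$) on real numbers, one addition or subtraction of integers, one copy, one load or store of an array entry, one comparison or control transfer, one draw of a uniform integer from $\{0,\dots,k-1\}$, or one draw of a Bernoulli$(p)$ variable, where $k$ and $p$ are contents of registers. **Theorem.** There are one such program and an absolute constant $C$ such that for all $d,n,s,\mathbf X,\lambda$ as above the following holds on input $(\mathbf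 X,n,d,s,\lambda)$: 1. the output of the program is distributed exactly according to $\lambda$-regularized size-$s$ volume sampling from $\mathbf X$; 2. for every $\delta>0$, with probability at least $1-\delta$ the program halts within $$C\left(n+d+\log^{+}\!\left(\frac nd\right)\log\left(\frac1\delta\right)\right)d^2$$ steps, where $\log^+ x=\max\{0,\log x\}$ (so $\log^+(n/d)=\log(n/d)$ when $n\ge d$) and $\log^+0=0$. -/

import Mathlib

/-! ## Regularized volume sampling -/

namespace VolumeSampling

variable {d n : ℕ}

/-- `X_S`: the columns of `X` with index in `S`. -/
def cols (X : Matrix (Fin d) (Fin n) ℝ) (S : Finset (Fin n)) : Matrix (Fin d) S ℝ :=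
  X.submatrix id Subtype.val

/-- `det (X_S X_Sᵀ + lam I)`. -/
noncomputable def regDet (X : Matrix (Fin d) (Fin n) ℝ) (lam : ℝ) (S : Finset (Fin n)) : ℝ :=
  (cols X S * (cols X S).transpose + lam • (1 : Matrix (Fin d) (Fin d) ℝ)).det

/-- The unnormalized weight `det (X_{S-i} X_{S-i}ᵀ + lam I) / det (X_S X_Sᵀ + lam I)`
of removing `i` from `S`. -/
noncomputable def removalWeight (X : Matrix (Fin d) (Fin n) ℝ) (lam : ℝ) (S : Finset (Fin n))
    (i : Fin n) : ℝ :=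
  regDet X lam (S.erase i) / regDet X lam S

/-- `P(i | S)`: the conditional probability of removing `i ∈ S` from the current set `S`. -/
noncomputable def removalProb (X : Matrix (Fin d) (Fin n) ℝ) (lam : ℝ) (S : Finset (Fin n))
    (i : Fin n) : ℝ :=
  removalWeight X lam S i / ∑ j ∈ S, removalWeight X lam S j

/-- The probability that, starting from `{1, …, n}`, the current set is `T` after `k` successive
random removals with the conditional probabilities `removalProb`. -/
noncomputable def probAfter (X : Matrix (Fin d) (Fin n) ℝ) (lam : ℝ) :
    ℕ → Finset (Fin n) → ℝ
  | 0, T => if T = Finset.univ then 1 else 0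
  | k + 1, T => ∑ i ∈ Tᶜ, probAfter X lam k (insert i T) * removalProb X lam (insert i T) i

/-- The probability of `T` under `lam`-regularized size `s` volume sampling from `X` (`s ≤ n`). -/
noncomputable def regVolProb (X : Matrix (Fin d) (Fin n) ℝ) (lam : ℝ) (s : ℕ)
    (T : Finset (Fin n)) : ℝ :=
  probAfter X lam (n - s) T

end VolumeSampling

/-! ## A randomized real RAM

Integer and real registers, integer arrays and two-dimensional real arrays. A program is a
finite piece of text; registers and arrays are named by literals occurring in it. Every
instruction performs one operation, and each instruction, test or control transfer is one step. -/

namespace RealRAM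

/-- Memory contents. -/
structure State where
  /-- integer registers -/
  nreg : ℕ → ℕ
  /-- real registers -/
  rreg : ℕ → ℝ
  /-- integer arrays: `narr A i` is the entry `A[i]` -/
  narr : ℕ → ℕ → ℕ
  /-- real arrays: `rarr A i j` is the entry `A[i][j]` -/
  rarr : ℕ → ℕ → ℕ → ℝ

/-- Elementary instructions; the first argument is the register or array written to. -/
inductive Instr where
  | nconst (a k : ℕ)
  | ncopy (a b : ℕ)
  | nadd (a b c : ℕ)
  | nsub (a b c : ℕ)
  | nload (a A i : ℕ)
  | nstore (A i a : ℕ)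
  | rconst (a : ℕ) (q : ℚ)
  | rcopy (a b : ℕ)
  | radd (a b c : ℕ)
  | rsub (a b c : ℕ)
  | rmul (a b c : ℕ)
  | rdiv (a b c : ℕ)
  | rload (a A i j : ℕ)
  | rstore (A i j a : ℕ)
  /-- integer register `a` receives a uniform element of `{0, …, b - 1}` (and `0` if `b = 0`),
  where `b` is the content of integer register `b` -/
  | unif (a b : ℕ)
  /-- integer register `a` receives a Bernoulli variable whose parameter is the content of real
  register `p`, truncated to `[0, 1]` -/
  | flip (a p : ℕ)

namespace State

def setN (σ : State) (a v : ℕ) : State :=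
  { σ with nreg := Function.update σ.nreg a v }

noncomputable def setR (σ : State) (a : ℕ) (v : ℝ) : State :=
  { σ with rreg := Function.update σ.rreg a v }

def setNArr (σ : State) (A i v : ℕ) : State :=
  { σ with narr := Function.update σ.narr A (Function.update (σ.narr A) i v) }

noncomputable def setRArr (σ : State) (A i j : ℕ) (v : ℝ) : State :=
  { σ with rarr := Function.update σ.rarr A (Function.update (σ.rarr A) i
      (Function.update (σ.rarr A i) j v)) }

end State

/-- The Bernoulli law with parameter `q`. -/
noncomputable def coin (q : NNReal) (hq : q ≤ 1) : PMF Bool :=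
  PMF.ofFintype (fun b => if b then (q : ENNReal) else 1 - q) (by
    simp only [Fintype.sum_bool, if_true, Bool.false_eq_true, if_false]
    exact add_tsub_cancel_of_le (by exact_mod_cast hq))

/-- The law of the memory contents after one instruction. -/
noncomputable def Instr.exec (σ : State) : Instr → PMF State
  | .nconst a k => PMF.pure (σ.setN a k)
  | .ncopy a b => PMF.pure (σ.setN a (σ.nreg b))
  | .nadd a b c => PMF.pure (σ.setN a (σ.nreg b + σ.nreg c))
  | .nsub a b c => PMF.pure (σ.setN a (σ.nreg b - σ.nreg c))
  | .nload a A i => PMF.pure (σ.setN a (σ.narr A (σ.nreg i)))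
  | .nstore A i a => PMF.pure (σ.setNArr A (σ.nreg i) (σ.nreg a))
  | .rconst a q => PMF.pure (σ.setR a (q : ℝ))
  | .rcopy a b => PMF.pure (σ.setR a (σ.rreg b))
  | .radd a b c => PMF.pure (σ.setR a (σ.rreg b + σ.rreg c))
  | .rsub a b c => PMF.pure (σ.setR a (σ.rreg b - σ.rreg c))
  | .rmul a b c => PMF.pure (σ.setR a (σ.rreg b * σ.rreg c))
  | .rdiv a b c => PMF.pure (σ.setR a (σ.rreg b / σ.rreg c))
  | .rload a A i j => PMF.pure (σ.setR a (σ.rarr A (σ.nreg i) (σ.nreg j)))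
  | .rstore A i j a => PMF.pure (σ.setRArr A (σ.nreg i) (σ.nreg j) (σ.rreg a))
  | .unif a b =>
      match σ.nreg b with
      | 0 => PMF.pure (σ.setN a 0)
      | k + 1 => (PMF.uniformOfFintype (Fin (k + 1))).map fun v => σ.setN a v
  | .flip a p =>
      (coin (min 1 (σ.rreg p).toNNReal) (min_le_left _ _)).map
        fun v => σ.setN a (if v then 1 else 0)

/-- Comparisons of two registers. -/
inductive Test where
  | nlt (a b : ℕ)
  | rlt (a b : ℕ)

def Test.Holds (σ : State) : Test → Prop
  | .nlt a b => σ.nreg a < σ.nreg b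
  | .rlt a b => σ.rreg a < σ.rreg b

/-- Programs: `cond t p q` is "if `t` then `p` else `q`", `loop t p` is "while `t` do `p`". -/
inductive Prog where
  | skip
  | op (o : Instr)
  | seq (p q : Prog)
  | cond (t : Test) (p q : Prog)
  | loop (t : Test) (p : Prog)

/-- The programs that remain to be executed, in this order, and the memory contents. -/
abbrev Config := List Prog × State

open Classical in
/-- The law of the configuration after one step; configurations `([], σ)` have halted. -/
noncomputable def step : Config → PMF Config
  | ([], σ) => PMF.pure ([], σ)
  | (.skip :: K, σ) => PMF.pure (K, σ)
  | (.op o :: K, σ) => (o.exec σ).map fun σ' => (K, σ')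
  | (.seq p q :: K, σ) => PMF.pure (p :: q :: K, σ)
  | (.cond t p q :: K, σ) => PMF.pure (if t.Holds σ then p :: K else q :: K, σ)
  | (.loop t p :: K, σ) => PMF.pure (if t.Holds σ then p :: .loop t p :: K else K, σ)

/-- The law of the configuration after a given number of steps. -/
noncomputable def run : ℕ → Config → PMF Config
  | 0, c => PMF.pure c
  | t + 1, c => (step c).bind (run t)

/-- The probability that program `p`, started on memory `σ`, halts within `t` steps with memory
contents satisfying `Q`. -/
noncomputable def haltProb (p : Prog) (σ : State) (t : ℕ) (Q : State → Prop) : ENNReal :=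
  (run t ([p], σ)).toOuterMeasure {c | c.1 = [] ∧ Q c.2}

/-- Input convention: `n`, `d`, `s` in integer registers `0`, `1`, `2`, the regularization
parameter in real register `0`, the matrix in real array `0`, and zeros elsewhere. -/
noncomputable def input {d n : ℕ} (X : Matrix (Fin d) (Fin n) ℝ) (lam : ℝ) (s : ℕ) : State where
  nreg a := if a = 0 then n else if a = 1 then d else if a = 2 then s else 0
  rreg a := if a = 0 then lam else 0
  narr _ _ := 0
  rarr A i j := if h : A = 0 ∧ i < d ∧ j < n then X ⟨i, h.2.1⟩ ⟨j, h.2.2⟩ else 0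

/-- Output convention: the sampled set is listed in the first `s` entries of integer array `0`. -/
def output (n s : ℕ) (σ : State) : Finset (Fin n) :=
  {j | (j : ℕ) ∈ (Finset.range s).image (σ.narr 0)}

end RealRAM

/-!
The inverse `A⁻¹` of `A = X_S X_Sᵀ + λ I` is maintained by the Sherman–Morrison formula, in `O(d²)`
steps per rank-one change of `A`; it is first built from the identity by adding the columns of `X`
one by one and then moving the ridge from `1` to `λ` along each unit vector.

By the matrix determinant lemma the weight of removing the column `x = X_i` is
`1 - xᵀ A⁻¹ x ∈ [0, 1]`, and the weights of all `i ∈ S` add up to at least `|S| - d`. Hence, while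
`|S| ≥ 2 d`, a uniform `i ∈ S` that is accepted with probability equal to its weight is accepted at
least half of the time, and given acceptance it has exactly the required conditional distribution.
Each trial multiplies the potential `2 ^ |S|` by at most `3 / 4` in expectation, so about
`4 n + 4 log (1 / δ)` trials suffice with probability at least `1 - δ`.

From `max s (2 d)` columns on, removals are needed only if there are at most `2 d` columns. The
weights of all of them are then kept in a table; after a removal, each entry changes by a multiple
of the square of an inner product, so an exact removal costs `O(d²)` steps as well.
-/

namespace RealRAM

/-! ## Deterministic executions -/

/-- Instructions that draw no random number. -/
def Instr.IsDet : Instr → Prop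
  | .unif _ _ => False
  | .flip _ _ => False
  | _ => True

/-- The effect of an instruction that draws no random number. The two random instructions are
given the identity as a dummy value. -/
noncomputable def Instr.det (σ : State) : Instr → State
  | .nconst a k => σ.setN a k
  | .ncopy a b => σ.setN a (σ.nreg b)
  | .nadd a b c => σ.setN a (σ.nreg b + σ.nreg c)
  | .nsub a b c => σ.setN a (σ.nreg b - σ.nreg c)
  | .nload a A i => σ.setN a (σ.narr A (σ.nreg i))
  | .nstore A i a => σ.setNArr A (σ.nreg i) (σ.nreg a)
  | .rconst a q => σ.setR a (q : ℝ)
  | .rcopy a b => σ.setR a (σ.rreg b)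
  | .radd a b c => σ.setR a (σ.rreg b + σ.rreg c)
  | .rsub a b c => σ.setR a (σ.rreg b - σ.rreg c)
  | .rmul a b c => σ.setR a (σ.rreg b * σ.rreg c)
  | .rdiv a b c => σ.setR a (σ.rreg b / σ.rreg c)
  | .rload a A i j => σ.setR a (σ.rarr A (σ.nreg i) (σ.nreg j))
  | .rstore A i j a => σ.setRArr A (σ.nreg i) (σ.nreg j) (σ.rreg a)
  | .unif _ _ => σ
  | .flip _ _ => σ

theorem Instr.IsDet.exec_eq {o : Instr} (h : o.IsDet) (σ : State) :
    o.exec σ = PMF.pure (o.det σ) := by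
  cases o <;> first | rfl | exact h.elim

/-- `Exec p σ k τ`: started on memory `σ`, program `p` draws no random number and halts after
exactly `k` steps with memory `τ`. -/
inductive Exec : Prog → State → ℕ → State → Prop
  | skip (σ) : Exec .skip σ 1 σ
  | op {o : Instr} (h : o.IsDet) (σ) : Exec (.op o) σ 1 (o.det σ)
  | seq {p q σ k τ l υ} : Exec p σ k τ → Exec q τ l υ → Exec (.seq p q) σ (l + k + 1) υ
  | cond_true {c : Test} {p q σ k τ} : c.Holds σ → Exec p σ k τ → Exec (.cond c p q) σ (k + 1) τ
  | cond_false {c : Test} {p q σ k τ} :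
      ¬ c.Holds σ → Exec q σ k τ → Exec (.cond c p q) σ (k + 1) τ
  | loop_true {c : Test} {p σ k τ l υ} :
      c.Holds σ → Exec p σ k τ → Exec (.loop c p) τ l υ → Exec (.loop c p) σ (l + k + 1) υ
  | loop_false {c : Test} {p σ} : ¬ c.Holds σ → Exec (.loop c p) σ 1 σ

theorem run_succ_of_step {c c' : Config} (h : step c = PMF.pure c') (t : ℕ) :
    run (t + 1) c = run t c' := by
  rw [run, h, PMF.pure_bind]

theorem step_loop_true {c : Test} {σ : State} (hc : c.Holds σ) (p : Prog) (K : List Prog) :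
    step (.loop c p :: K, σ) = PMF.pure (p :: .loop c p :: K, σ) := by
  simp [step, hc]

theorem Exec.run_eq {p σ k τ} (h : Exec p σ k τ) (K : List Prog) (t : ℕ) :
    run (t + k) (p :: K, σ) = run t (K, τ) := by
  induction h generalizing K t with
  | skip σ => exact run_succ_of_step rfl t
  | op h σ => exact run_succ_of_step (by simp [step, h.exec_eq, PMF.pure_map]) t
  | seq _ _ ihp ihq => rw [← add_assoc, ← add_assoc, run_succ_of_step rfl, ihp, ihq]
  | cond_true hc _ ih => exact (run_succ_of_step (by simp [step, hc]) _).trans (ih _ _)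
  | cond_false hc _ ih => exact (run_succ_of_step (by simp [step, hc]) _).trans (ih _ _)
  | loop_true hc _ _ ihp ihl =>
    rw [← add_assoc, ← add_assoc, run_succ_of_step (step_loop_true hc _ K), ihp, ihl]
  | loop_false hc => exact run_succ_of_step (by simp [step, hc]) t

/-- Total correctness with a time bound: from memory `σ`, program `p` deterministically halts
within `k` steps, with memory contents satisfying `P`. -/
def Ensures (p : Prog) (σ : State) (k : ℕ) (P : State → Prop) : Prop :=
  ∃ τ, ∃ k' ≤ k, Exec p σ k' τ ∧ P τ

namespace Ensures

variable {p q : Prog} {σ : State} {k l : ℕ} {P R : State → Prop}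

theorem mono (h : Ensures p σ k P) (hk : k ≤ l) (hP : ∀ τ, P τ → R τ) : Ensures p σ l R := by
  obtain ⟨τ, k', hk', hexec, hτ⟩ := h
  exact ⟨τ, k', hk'.trans hk, hexec, hP τ hτ⟩

theorem op {o : Instr} (ho : o.IsDet) (h : P (o.det σ)) : Ensures (.op o) σ 1 P :=
  ⟨_, 1, le_rfl, .op ho σ, h⟩

theorem skip (h : P σ) : Ensures .skip σ 1 P :=
  ⟨σ, 1, le_rfl, .skip σ, h⟩

theorem seq (hp : Ensures p σ k P) (hq : ∀ τ, P τ → Ensures q τ l R) :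
    Ensures (.seq p q) σ (k + l + 1) R := by
  obtain ⟨τ, k', hk', hpexec, hτ⟩ := hp
  obtain ⟨υ, l', hl', hqexec, hυ⟩ := hq τ hτ
  exact ⟨υ, _, by omega, .seq hpexec hqexec, hυ⟩

theorem cond_true {c : Test} (hc : c.Holds σ) (h : Ensures p σ k P) :
    Ensures (.cond c p q) σ (k + 1) P := by
  obtain ⟨τ, k', hk', hexec, hτ⟩ := h
  exact ⟨τ, _, by omega, .cond_true hc hexec, hτ⟩

theorem cond_false {c : Test} (hc : ¬ c.Holds σ) (h : Ensures q σ k P) :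
    Ensures (.cond c p q) σ (k + 1) P := by
  obtain ⟨τ, k', hk', hexec, hτ⟩ := h
  exact ⟨τ, _, by omega, .cond_false hc hexec, hτ⟩

theorem loop {c : Test} {N : ℕ} (I : ℕ → State → Prop)
    (hc : ∀ i τ, i ≤ N → I i τ → (c.Holds τ ↔ i < N))
    (hp : ∀ i τ, i < N → I i τ → Ensures p τ k (I (i + 1))) (h0 : I 0 σ) :
    Ensures (.loop c p) σ (N * (k + 1) + 1) (I N) := by
  suffices h : ∀ m i τ, i + m = N → I i τ → Ensures (.loop c p) τ (m * (k + 1) + 1) (I N) from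
    h N 0 σ (zero_add N) h0
  intro m
  induction m with
  | zero =>
    rintro i τ rfl hI
    exact ⟨τ, 1, by omega, .loop_false (by simp [hc i τ le_rfl hI]), hI⟩
  | succ m ih =>
    intro i τ hi hI
    obtain ⟨υ, k', hk', hbody, hυ⟩ := hp i τ (by omega) hI
    obtain ⟨ω, l', hl', hrest, hω⟩ := ih (i + 1) υ (by omega) hυ
    exact ⟨ω, _, by rw [add_one_mul]; omega,
      .loop_true ((hc i τ (by omega) hI).2 (by omega)) hbody hrest, hω⟩

end Ensures

/-! ## Straight-line code -/

/-- Straight-line code: the instructions of a list, one after the other. -/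
def block : List Instr → Prog
  | [] => .skip
  | o :: l => .seq (.op o) (block l)

/-- The effect of straight-line code. -/
noncomputable def execs : List Instr → State → State
  | [], σ => σ
  | o :: l, σ => execs l (o.det σ)

theorem Ensures.block {l : List Instr} {P : State → Prop} (hl : ∀ o ∈ l, o.IsDet) {σ : State}
    (h : P (execs l σ)) : Ensures (block l) σ (2 * l.length + 1) P := by
  induction l generalizing σ with
  | nil => exact .skip h
  | cons o l ih =>
    refine (Ensures.seq (P := (· = o.det σ)) (l := 2 * l.length + 1) (.op (hl o (by simp)) rfl)
      ?_).mono (by rw [List.length_cons]; omega) fun _ => id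
    rintro _ rfl
    exact ih (fun o ho => hl o (by simp [ho])) h

theorem Ensures.block_seq {l : List Instr} {q : Prog} {σ : State} {k : ℕ} {P : State → Prop}
    (hl : ∀ o ∈ l, o.IsDet) (hq : Ensures q (execs l σ) k P) :
    Ensures (.seq (RealRAM.block l) q) σ (2 * l.length + k + 2) P :=
  (Ensures.seq (P := (· = execs l σ)) (.block hl rfl) fun _ h => h ▸ hq).mono (by omega)
    fun _ => id

namespace State

variable (σ : State) (a b A B i j k l : ℕ)

@[simp] theorem nreg_setN (v : ℕ) : (σ.setN a v).nreg b = if b = a then v else σ.nreg b := by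
  simp [setN, Function.update_apply]

@[simp] theorem rreg_setN (v : ℕ) : (σ.setN a v).rreg = σ.rreg := rfl
@[simp] theorem narr_setN (v : ℕ) : (σ.setN a v).narr = σ.narr := rfl
@[simp] theorem rarr_setN (v : ℕ) : (σ.setN a v).rarr = σ.rarr := rfl

@[simp] theorem rreg_setR (v : ℝ) : (σ.setR a v).rreg b = if b = a then v else σ.rreg b := by
  simp [setR, Function.update_apply]

@[simp] theorem nreg_setR (v : ℝ) : (σ.setR a v).nreg = σ.nreg := rfl
@[simp] theorem narr_setR (v : ℝ) : (σ.setR a v).narr = σ.narr := rfl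
@[simp] theorem rarr_setR (v : ℝ) : (σ.setR a v).rarr = σ.rarr := rfl

@[simp] theorem narr_setNArr (v : ℕ) :
    (σ.setNArr A i v).narr B j = if B = A ∧ j = i then v else σ.narr B j := by
  simp only [setNArr, Function.update_apply]
  split_ifs <;> simp_all

@[simp] theorem nreg_setNArr (v : ℕ) : (σ.setNArr A i v).nreg = σ.nreg := rfl
@[simp] theorem rreg_setNArr (v : ℕ) : (σ.setNArr A i v).rreg = σ.rreg := rfl
@[simp] theorem rarr_setNArr (v : ℕ) : (σ.setNArr A i v).rarr = σ.rarr := rfl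

@[simp] theorem rarr_setRArr (v : ℝ) :
    (σ.setRArr A i j v).rarr B k l = if B = A ∧ k = i ∧ l = j then v else σ.rarr B k l := by
  by_cases hB : B = A <;> by_cases hk : k = i <;> by_cases hl : l = j <;>
    simp [setRArr, hB, hk, hl]

@[simp] theorem nreg_setRArr (v : ℝ) : (σ.setRArr A i j v).nreg = σ.nreg := rfl
@[simp] theorem rreg_setRArr (v : ℝ) : (σ.setRArr A i j v).rreg = σ.rreg := rfl

end State

/-! ## The frame rule -/

/-- A part of the memory: a set of registers and arrays of each kind. -/
structure Region where
  /-- integer registers -/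
  nreg : Set ℕ
  /-- real registers -/
  rreg : Set ℕ
  /-- integer arrays -/
  narr : Set ℕ
  /-- real arrays -/
  rarr : Set ℕ

namespace Region

/-- Two memories have the same contents in the region `D`. -/
structure Agree (D : Region) (σ τ : State) : Prop where
  nreg : ∀ a ∈ D.nreg, τ.nreg a = σ.nreg a
  rreg : ∀ a ∈ D.rreg, τ.rreg a = σ.rreg a
  narr : ∀ A ∈ D.narr, τ.narr A = σ.narr A
  rarr : ∀ A ∈ D.rarr, τ.rarr A = σ.rarr A

variable {D : Region} {σ τ υ : State}

theorem Agree.refl (σ : State) : D.Agree σ σ :=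
  ⟨fun _ _ => rfl, fun _ _ => rfl, fun _ _ => rfl, fun _ _ => rfl⟩

theorem Agree.trans (h : D.Agree σ τ) (h' : D.Agree τ υ) : D.Agree σ υ where
  nreg a ha := (h'.nreg a ha).trans (h.nreg a ha)
  rreg a ha := (h'.rreg a ha).trans (h.rreg a ha)
  narr A hA := (h'.narr A hA).trans (h.narr A hA)
  rarr A hA := (h'.rarr A hA).trans (h.rarr A hA)

theorem Agree.setN {a : ℕ} (h : D.Agree σ τ) (ha : a ∉ D.nreg) (v : ℕ) :
    D.Agree σ (τ.setN a v) where
  nreg b hb := by simp [h.nreg b hb, ne_of_mem_of_not_mem hb ha]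
  rreg := h.rreg
  narr := h.narr
  rarr := h.rarr

theorem Agree.setR {a : ℕ} (h : D.Agree σ τ) (ha : a ∉ D.rreg) (v : ℝ) :
    D.Agree σ (τ.setR a v) where
  nreg := h.nreg
  rreg b hb := by simp [h.rreg b hb, ne_of_mem_of_not_mem hb ha]
  narr := h.narr
  rarr := h.rarr

theorem Agree.setNArr {A : ℕ} (h : D.Agree σ τ) (hA : A ∉ D.narr) (i v : ℕ) :
    D.Agree σ (τ.setNArr A i v) where
  nreg := h.nreg
  rreg := h.rreg
  narr B hB := by
    ext j
    simp [h.narr B hB, ne_of_mem_of_not_mem hB hA]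
  rarr := h.rarr

theorem Agree.setRArr {A : ℕ} (h : D.Agree σ τ) (hA : A ∉ D.rarr) (i j : ℕ) (v : ℝ) :
    D.Agree σ (τ.setRArr A i j v) where
  nreg := h.nreg
  rreg := h.rreg
  narr := h.narr
  rarr B hB := by
    ext k l
    simp [h.rarr B hB, ne_of_mem_of_not_mem hB hA]

end Region

/-- The instruction does not write into the region `D`. -/
def Instr.Preserves (D : Region) : Instr → Prop
  | .nconst a _ | .ncopy a _ | .nadd a _ _ | .nsub a _ _ | .nload a _ _ => a ∉ D.nreg
  | .rconst a _ | .rcopy a _ | .radd a _ _ | .rsub a _ _ | .rmul a _ _ | .rdiv a _ _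
  | .rload a _ _ _ => a ∉ D.rreg
  | .nstore A _ _ => A ∉ D.narr
  | .rstore A _ _ _ => A ∉ D.rarr
  | .unif a _ | .flip a _ => a ∉ D.nreg

/-- No instruction of the program writes into the region `D`. -/
def Prog.Preserves (D : Region) : Prog → Prop
  | .skip => True
  | .op o => o.Preserves D
  | .seq p q | .cond _ p q => p.Preserves D ∧ q.Preserves D
  | .loop _ p => p.Preserves D

theorem Instr.Preserves.agree {D : Region} {o : Instr} (h : o.Preserves D) (σ : State) :
    D.Agree σ (o.det σ) := by
  have hrefl := Region.Agree.refl (D := D) σ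
  cases o with
  | nstore => exact hrefl.setNArr h _ _
  | rstore => exact hrefl.setRArr h _ _ _
  | rconst | rcopy | radd | rsub | rmul | rdiv | rload => exact hrefl.setR h _
  | unif | flip => exact hrefl
  | _ => exact hrefl.setN h _

theorem Exec.agree {D : Region} {p σ k τ} (h : Exec p σ k τ) (hp : p.Preserves D) :
    D.Agree σ τ := by
  induction h with
  | skip σ => exact .refl σ
  | op _ σ => exact Instr.Preserves.agree hp σ
  | seq _ _ ihp ihq => exact (ihp hp.1).trans (ihq hp.2)
  | cond_true _ _ ih => exact ih hp.1
  | cond_false _ _ ih => exact ih hp.2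
  | loop_true _ _ _ ihp ihl => exact (ihp hp).trans (ihl hp)
  | loop_false => exact .refl _

theorem Ensures.frame {D : Region} {p : Prog} {σ : State} {k : ℕ} {P : State → Prop}
    (h : Ensures p σ k P) (hp : p.Preserves D) : Ensures p σ k fun τ => D.Agree σ τ ∧ P τ := by
  obtain ⟨τ, k', hk', hexec, hτ⟩ := h
  exact ⟨τ, k', hk', hexec, hexec.agree hp, hτ⟩

/-- The region `D` together with the integer register `c`. -/
def Region.insertNReg (c : ℕ) (D : Region) : Region :=
  { D with nreg := insert c D.nreg }

/-- `for c = 0, …, b - 1 do p`, for integer registers `c` and `b`. Integer register `4` has to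
hold the number `1`. -/
def forProg (c b : ℕ) (p : Prog) : Prog :=
  .seq (.op (.nconst c 0)) (.loop (.nlt c b) (.seq p (.op (.nadd c c 4))))

theorem Ensures.forProg {D : Region} {c b : ℕ} {p : Prog} {σ : State} {N k : ℕ}
    (I : ℕ → State → Prop) (hp : p.Preserves (D.insertNReg c)) (hc : c ∉ D.nreg)
    (hb : b ∈ D.nreg) (h4 : 4 ∈ D.nreg) (hbN : σ.nreg b = N) (h4σ : σ.nreg 4 = 1)
    (hI : ∀ i τ v, I i τ → I i (τ.setN c v)) (h0 : I 0 σ)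
    (hbody : ∀ i τ, i < N → D.Agree σ τ → τ.nreg c = i → I i τ → Ensures p τ k (I (i + 1))) :
    Ensures (forProg c b p) σ (N * (k + 3) + 3) fun τ => D.Agree σ τ ∧ I N τ := by
  let J (i : ℕ) (τ : State) : Prop := τ.nreg c = i ∧ D.Agree σ τ ∧ I i τ
  refine (Ensures.seq (P := J 0) (.op (o := .nconst c 0) trivial
    ⟨by simp [Instr.det], (Region.Agree.refl σ).setN hc 0, hI _ _ _ h0⟩) fun τ hτ =>
      Ensures.loop (N := N) (k := k + 2) J (fun i υ _ hυ => ?_) (fun i υ hi hυ => ?_) hτ).mono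
        (le_of_eq (by ring)) fun τ hτ => hτ.2
  · simp [Test.Holds, hυ.1, hυ.2.1.nreg b hb, hbN]
  · obtain ⟨hcυ, hυ, hIυ⟩ := hυ
    refine ((hbody i υ hi hυ hcυ hIυ).frame hp).seq (l := 1) fun ω ⟨hω, hIω⟩ =>
      .op (o := .nadd c c 4) trivial ?_
    have hDω : D.Agree σ ω := hυ.trans ⟨fun a ha => hω.nreg a (.inr ha), hω.rreg, hω.narr, hω.rarr⟩
    refine ⟨?_, hDω.setN hc _, hI _ _ _ hIω⟩
    simp [Instr.det, hω.nreg c (.inl rfl), hcυ, hDω.nreg 4 h4, h4σ]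

/-! ## Halting probabilities -/

/-- The probability that the programs `K`, executed one after the other on memory `σ`, halt within
`t` steps with memory contents satisfying `Q`. -/
noncomputable def contProb (Q : State → Prop) (t : ℕ) (K : List Prog) (σ : State) : ℝ :=
  ((run t (K, σ)).toOuterMeasure {c | c.1 = [] ∧ Q c.2}).toReal

variable {Q : State → Prop}

theorem toOuterMeasure_le_one {α : Type*} (p : PMF α) (s : Set α) : p.toOuterMeasure s ≤ 1 := by
  rw [PMF.toOuterMeasure_apply, ← p.tsum_coe]
  exact ENNReal.tsum_le_tsum fun a => Set.indicator_le_self s p a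

theorem toOuterMeasure_ne_top {α : Type*} (p : PMF α) (s : Set α) : p.toOuterMeasure s ≠ ⊤ :=
  ((toOuterMeasure_le_one p s).trans_lt ENNReal.one_lt_top).ne

theorem contProb_nonneg (t : ℕ) (K : List Prog) (σ : State) : 0 ≤ contProb Q t K σ :=
  ENNReal.toReal_nonneg

theorem haltProb_eq_ofReal_contProb (p : Prog) (σ : State) (t : ℕ) :
    haltProb p σ t Q = ENNReal.ofReal (contProb Q t [p] σ) :=
  (ENNReal.ofReal_toReal (toOuterMeasure_ne_top _ _)).symm

theorem toOuterMeasure_run_mono (c : Config) :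
    Monotone fun t => (run t c).toOuterMeasure {c | c.1 = [] ∧ Q c.2} := by
  refine monotone_nat_of_le_succ fun t => ?_
  induction t generalizing c with
  | zero =>
    obtain ⟨K, σ⟩ := c
    by_cases hK : K = []
    · subst hK
      rw [run_succ_of_step (c' := ([], σ)) rfl]
    · simp [run, PMF.toOuterMeasure_pure_apply, hK]
  | succ t ih =>
    rw [run, run, PMF.toOuterMeasure_bind_apply, PMF.toOuterMeasure_bind_apply]
    exact ENNReal.tsum_le_tsum fun c => mul_le_mul_right (ih c) _

theorem contProb_mono (K : List Prog) (σ : State) : Monotone fun t => contProb Q t K σ :=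
  fun _ _ h => ENNReal.toReal_mono (toOuterMeasure_ne_top _ _) (toOuterMeasure_run_mono (K, σ) h)

theorem contProb_nil {σ : State} (h : Q σ) (t : ℕ) : contProb Q t [] σ = 1 := by
  refine le_antisymm (ENNReal.toReal_le_of_le_ofReal zero_le_one
    (by simpa using toOuterMeasure_le_one _ _)) ?_
  refine le_trans ?_ (contProb_mono [] σ (Nat.zero_le t))
  simp [contProb, run, PMF.toOuterMeasure_pure_apply, h]

theorem contProb_zero_cons (p : Prog) (K : List Prog) (σ : State) :
    contProb Q 0 (p :: K) σ = 0 := by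
  simp [contProb, run, PMF.toOuterMeasure_pure_apply]

theorem contProb_succ_of_step {K K' : List Prog} {σ τ : State}
    (h : step (K, σ) = PMF.pure (K', τ)) (t : ℕ) :
    contProb Q (t + 1) K σ = contProb Q t K' τ := by
  rw [contProb, contProb, run_succ_of_step h]

theorem Ensures.le_contProb {p : Prog} {σ : State} {k : ℕ} {P : State → Prop}
    (h : Ensures p σ k P) {t : ℕ} {K : List Prog} {x : ℝ}
    (hx : ∀ τ, P τ → x ≤ contProb Q t K τ) : x ≤ contProb Q (t + k) (p :: K) σ := by
  obtain ⟨τ, k', hk', hexec, hτ⟩ := h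
  calc x ≤ contProb Q t K τ := hx τ hτ
    _ = contProb Q (t + k') (p :: K) σ := by rw [contProb, contProb, hexec.run_eq]
    _ ≤ contProb Q (t + k) (p :: K) σ := contProb_mono _ _ (by omega)

theorem contProb_seq (p q : Prog) (K : List Prog) (σ : State) (t : ℕ) :
    contProb Q (t + 1) (.seq p q :: K) σ = contProb Q t (p :: q :: K) σ :=
  contProb_succ_of_step rfl t

theorem contProb_loop_true {c : Test} {σ : State} (hc : c.Holds σ) (p : Prog) (K : List Prog)
    (t : ℕ) : contProb Q (t + 1) (.loop c p :: K) σ = contProb Q t (p :: .loop c p :: K) σ :=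
  contProb_succ_of_step (step_loop_true hc p K) t

theorem contProb_unif {σ : State} {b m : ℕ} (hm : σ.nreg b = m) (h0 : 0 < m) (a : ℕ)
    (K : List Prog) (t : ℕ) :
    contProb Q (t + 1) (.op (.unif a b) :: K) σ =
      ∑ v ∈ Finset.range m, (1 / m : ℝ) * contProb Q t K (σ.setN a v) := by
  obtain ⟨m, rfl⟩ := Nat.exists_eq_add_one_of_ne_zero h0.ne'
  have hstep : step (.op (.unif a b) :: K, σ) =
      (PMF.uniformOfFintype (Fin (m + 1))).map fun v : Fin (m + 1) => (K, σ.setN a (v : ℕ)) := by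
    rw [step, Instr.exec]
    split
    · omega
    · next k hk =>
      obtain rfl : k = m := by omega
      rw [PMF.map_comp]
      exact PMF.map_comp (fun v : Fin (k + 1) => (v : ℕ)) _ _
  rw [contProb, run, hstep, PMF.bind_map, PMF.toOuterMeasure_bind_apply, tsum_fintype,
    ENNReal.toReal_sum fun _ _ => ENNReal.mul_ne_top (PMF.apply_ne_top _ _)
      (toOuterMeasure_ne_top _ _), Finset.sum_range]
  refine Finset.sum_congr rfl fun v _ => ?_
  have hcast : ((m : ENNReal) + 1).toReal = m + 1 := mod_cast ENNReal.toReal_natCast (m + 1)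
  simp [contProb, ENNReal.toReal_mul, hcast]

theorem contProb_flip {σ : State} {b : ℕ} {p : ℝ} (hp : σ.rreg b = p) (h0 : 0 ≤ p) (h1 : p ≤ 1)
    (a : ℕ) (K : List Prog) (t : ℕ) :
    contProb Q (t + 1) (.op (.flip a b) :: K) σ =
      p * contProb Q t K (σ.setN a 1) + (1 - p) * contProb Q t K (σ.setN a 0) := by
  have hq : min 1 (σ.rreg b).toNNReal = p.toNNReal := by
    rw [hp]
    exact min_eq_right (by simpa using h1)
  have hstep : step (.op (.flip a b) :: K, σ) =
      (coin (min 1 (σ.rreg b).toNNReal) (min_le_left _ _)).map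
        fun v => (K, σ.setN a (if v then 1 else 0)) := by
    simp [step, Instr.exec, PMF.map_comp, Function.comp_def]
  rw [contProb, run, hstep, PMF.bind_map, PMF.toOuterMeasure_bind_apply, tsum_fintype,
    ENNReal.toReal_sum fun _ _ => ENNReal.mul_ne_top (PMF.apply_ne_top _ _)
      (toOuterMeasure_ne_top _ _)]
  have h1' : ENNReal.ofReal p ≤ 1 := by simpa using h1
  simp only [Fintype.sum_bool, ENNReal.toReal_mul, coin, PMF.ofFintype_apply, hq]
  simp [contProb, h0, ENNReal.toReal_sub_of_le, h1', ← ENNReal.ofReal.eq_1]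

/-! ## Sampling programs -/

/-- From memory `σ`, program `p` halts within `k` steps in the outcome `i ∈ S` with probability at
least `w i`, where `P i` is a property of the memory in that outcome. As the properties `P i` need
not exclude each other, this is expressed through the continuations `K` of `p`. -/
def Samples {ι : Type*} (p : Prog) (σ : State) (k : ℕ) (S : Finset ι) (w : ι → ℝ)
    (P : ι → State → Prop) : Prop :=
  ∀ (Q : State → Prop) (t : ℕ) (K : List Prog) (x : ι → ℝ),
    (∀ i ∈ S, ∀ τ, P i τ → x i ≤ contProb Q t K τ) →
      ∑ i ∈ S, w i * x i ≤ contProb Q (t + k) (p :: K) σ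

namespace Samples

variable {ι κ : Type*} {p q : Prog} {σ : State} {k l : ℕ} {S : Finset ι} {T : Finset κ}
  {w : ι → ℝ} {P : ι → State → Prop} {R : κ → State → Prop}

theorem mono (h : Samples p σ k S w P) (hk : k ≤ l) {P' : ι → State → Prop}
    (hP : ∀ i ∈ S, ∀ τ, P i τ → P' i τ) : Samples p σ l S w P' := fun Q t K x hx =>
  (h Q t K x fun i hi τ hτ => hx i hi τ (hP i hi τ hτ)).trans (contProb_mono _ _ (by omega))

theorem congr (h : Samples p σ k S w P) {w' : ι → ℝ} (hw : ∀ i ∈ S, w i = w' i) :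
    Samples p σ k S w' P := fun Q t K x hx =>
  (Finset.sum_congr rfl fun i hi => by rw [hw i hi]).trans_le (h Q t K x hx)

theorem and_ne_zero (h : Samples p σ k S w P) :
    Samples p σ k S w fun i τ => P i τ ∧ w i ≠ 0 := by
  classical
  intro Q t K x hx
  refine le_of_eq_of_le (Finset.sum_congr rfl fun i _ => ?_)
    (h Q t K (fun i => if w i = 0 then 0 else x i) fun i hi τ hτ => ?_)
  · by_cases hw : w i = 0 <;> simp [hw]
  · split_ifs with hw
    · exact contProb_nonneg _ _ _
    · exact hx i hi τ ⟨hτ, hw⟩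

theorem of_ensures [DecidableEq ι] {P₀ : State → Prop} (h : Ensures p σ k P₀) {i : ι} (hi : i ∈ S)
    (hP : ∀ τ, P₀ τ → P i τ) : Samples p σ k S (Pi.single i 1) P := fun Q t K x hx => by
  have hsum : ∑ j ∈ S, (Pi.single i 1 : ι → ℝ) j * x j = x i := by
    rw [Finset.sum_eq_single_of_mem i hi fun j _ hj => by simp [hj]]
    simp
  exact hsum.trans_le (h.le_contProb fun τ hτ => hx i hi τ (hP τ hτ))

theorem seq_prod {w' : ι → κ → ℝ} {R : ι × κ → State → Prop} (hp : Samples p σ k S w P)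
    (hq : ∀ i ∈ S, ∀ τ, P i τ → Samples q τ l T (w' i) fun j => R (i, j)) :
    Samples (.seq p q) σ (k + l + 1) (S ×ˢ T) (fun x => w x.1 * w' x.1 x.2) R :=
  fun Q t K x hx => by
    calc ∑ y ∈ S ×ˢ T, w y.1 * w' y.1 y.2 * x y
        = ∑ i ∈ S, w i * ∑ j ∈ T, w' i j * x (i, j) := by
          simp_rw [Finset.sum_product, Finset.mul_sum, mul_assoc]
      _ ≤ contProb Q (t + l + k) (p :: q :: K) σ := hp Q _ _ _ fun i hi τ hτ =>
          hq i hi τ hτ Q t K _ fun j hj => hx (i, j) (Finset.mk_mem_product hi hj)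
      _ = contProb Q (t + (k + l + 1)) (.seq p q :: K) σ := by
          rw [← contProb_seq]
          congr 1
          omega

theorem seq {w' : ι → κ → ℝ} (hp : Samples p σ k S w P)
    (hq : ∀ i ∈ S, ∀ τ, P i τ → Samples q τ l T (w' i) R) :
    Samples (.seq p q) σ (k + l + 1) T (fun j => ∑ i ∈ S, w i * w' i j) R := fun Q t K x hx => by
  refine le_of_eq_of_le ?_ (hp.seq_prod (R := fun y => R y.2) hq Q t K (fun y => x y.2)
    fun y hy => hx y.2 (Finset.mem_product.1 hy).2)
  simp_rw [Finset.sum_product, Finset.sum_mul]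
  exact Finset.sum_comm

theorem ensures_seq {P₀ : State → Prop} (hp : Ensures p σ k P₀)
    (hq : ∀ τ, P₀ τ → Samples q τ l S w P) : Samples (.seq p q) σ (k + l + 1) S w P :=
  ((of_ensures (S := {()}) (P := fun _ => P₀) hp (Finset.mem_singleton_self ()) fun _ => id).seq
    fun _ _ => hq).congr fun i _ => by simp

theorem seq_ensures {P' : ι → State → Prop} (hp : Samples p σ k S w P)
    (hq : ∀ i ∈ S, ∀ τ, P i τ → Ensures q τ l (P' i)) :
    Samples (.seq p q) σ (k + l + 1) S w P' := by
  classical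
  exact (hp.seq fun i hi τ hτ => of_ensures (hq i hi τ hτ) hi fun _ => id).congr
    fun j hj => by simp [Pi.single_apply, hj]

theorem loop_true {c : Test} (hc : c.Holds σ) (h : Samples (.seq p (.loop c p)) σ k S w P) :
    Samples (.loop c p) σ k S w P := fun Q t K x hx => by
  refine (h Q t K x hx).trans_eq ?_
  cases t + k with
  | zero => rw [contProb_zero_cons, contProb_zero_cons]
  | succ u => rw [contProb_seq, contProb_loop_true hc]

theorem unif {b m : ℕ} (hm : σ.nreg b = m) (h0 : 0 < m) (a : ℕ) :
    Samples (.op (.unif a b)) σ 1 (Finset.range m) (fun _ => 1 / m) fun v τ => τ = σ.setN a v :=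
  fun _ t K _ hx => by
    rw [contProb_unif hm h0 a K t]
    exact Finset.sum_le_sum fun v hv =>
      mul_le_mul_of_nonneg_left (hx v hv _ rfl) (by positivity)

theorem flip {b : ℕ} {r : ℝ} (hr : σ.rreg b = r) (h0 : 0 ≤ r) (h1 : r ≤ 1) (a : ℕ) :
    Samples (.op (.flip a b)) σ 1 Finset.univ (fun v : Bool => if v then r else 1 - r)
      fun v τ => τ = σ.setN a (if v then 1 else 0) := fun _ t K _ hx => by
  rw [contProb_flip hr h0 h1 a K t]
  simpa using add_le_add
    (mul_le_mul_of_nonneg_left (hx true (Finset.mem_univ _) _ rfl) h0)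
    (mul_le_mul_of_nonneg_left (hx false (Finset.mem_univ _) _ rfl) (sub_nonneg.2 h1))

end Samples

end RealRAM

namespace VolumeSampling

open Matrix

/-! ## Rank-one updates -/

section RankOne

theorem posSemidef_vecMulVec_self {m : Type*} [Finite m] (v : m → ℝ) :
    (vecMulVec v v).PosSemidef := by
  simpa using posSemidef_vecMulVec_self_star v

variable {m n K : Type*} [Fintype m] [Fintype n] [DecidableEq m]

theorem det_add_vecMulVec {R : Type*} [CommRing R] {A : Matrix m m R} (hA : IsUnit A.det)
    (u v : m → R) : (A + vecMulVec u v).det = A.det * (1 + v ⬝ᵥ A⁻¹ *ᵥ u) := by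
  rw [vecMulVec_eq Unit, det_add_replicateCol_mul_replicateRow hA]
  congr 1
  rw [Matrix.mul_assoc, ← replicateCol_mulVec, det_unique, Matrix.add_apply, one_apply_eq,
    replicateRow_mul_replicateCol_apply]

/-- The Sherman–Morrison formula. -/
theorem inv_add_vecMulVec [Field K] {A : Matrix m m K} (hA : IsUnit A.det) {u v : m → K}
    (huv : 1 + v ⬝ᵥ A⁻¹ *ᵥ u ≠ 0) :
    (A + vecMulVec u v)⁻¹ =
      A⁻¹ - (1 + v ⬝ᵥ A⁻¹ *ᵥ u)⁻¹ • vecMulVec (A⁻¹ *ᵥ u) (v ᵥ* A⁻¹) := by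
  refine inv_eq_right_inv ?_
  have hAu : A * vecMulVec (A⁻¹ *ᵥ u) (v ᵥ* A⁻¹) = vecMulVec u (v ᵥ* A⁻¹) := by
    rw [mul_vecMulVec, mulVec_mulVec, mul_nonsing_inv _ hA, one_mulVec]
  have huvA : vecMulVec u v * vecMulVec (A⁻¹ *ᵥ u) (v ᵥ* A⁻¹) =
      (v ⬝ᵥ A⁻¹ *ᵥ u) • vecMulVec u (v ᵥ* A⁻¹) := by
    rw [vecMulVec_mul_vecMulVec, vecMulVec_smul]
  calc (A + vecMulVec u v) * (A⁻¹ - (1 + v ⬝ᵥ A⁻¹ *ᵥ u)⁻¹ • vecMulVec (A⁻¹ *ᵥ u) (v ᵥ* A⁻¹))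
      = 1 + vecMulVec u (v ᵥ* A⁻¹) - (1 + v ⬝ᵥ A⁻¹ *ᵥ u)⁻¹ •
          ((1 + v ⬝ᵥ A⁻¹ *ᵥ u) • vecMulVec u (v ᵥ* A⁻¹)) := by
        rw [mul_sub, Matrix.mul_smul, Matrix.add_mul, Matrix.add_mul, mul_nonsing_inv _ hA,
          vecMulVec_mul, hAu, huvA, add_smul, one_smul]
    _ = 1 := by rw [inv_smul_smul₀ huv, add_sub_cancel_right]

theorem inv_add_smul_vecMulVec_self [Field K] {A : Matrix m m K} (hA : IsUnit A.det)
    (hsymm : A.IsSymm) {v : m → K} {c : K} (hc : 1 + c * (v ⬝ᵥ A⁻¹ *ᵥ v) ≠ 0) :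
    (A + c • vecMulVec v v)⁻¹ = A⁻¹ -
      (c / (1 + c * (v ⬝ᵥ A⁻¹ *ᵥ v))) • vecMulVec (A⁻¹ *ᵥ v) (A⁻¹ *ᵥ v) := by
  have hv : v ᵥ* A⁻¹ = A⁻¹ *ᵥ v := by rw [← vecMul_transpose, transpose_nonsing_inv, hsymm.eq]
  have hq : v ⬝ᵥ A⁻¹ *ᵥ (c • v) = c * (v ⬝ᵥ A⁻¹ *ᵥ v) := by
    rw [mulVec_smul, dotProduct_smul, smul_eq_mul]
  rw [← smul_vecMulVec, inv_add_vecMulVec hA (by rwa [hq]), hq, hv, mulVec_smul, smul_vecMulVec,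
    smul_smul, div_eq_inv_mul]

theorem one_add_mul_dotProduct_inv_mulVec_pos {A : Matrix m m ℝ} (hA : A.PosDef) {v : m → ℝ}
    {c : ℝ} (hB : (A + c • vecMulVec v v).PosDef) : 0 < 1 + c * (v ⬝ᵥ A⁻¹ *ᵥ v) := by
  have hdet := hB.det_pos
  rw [← smul_vecMulVec, det_add_vecMulVec hA.det_pos.ne'.isUnit, mulVec_smul, dotProduct_smul,
    smul_eq_mul] at hdet
  exact pos_of_mul_pos_right hdet hA.det_pos.le

theorem posDef_gram_add_diagonal (X : Matrix m n ℝ) {v : m → ℝ} (hv : ∀ i, 0 ≤ v i)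
    (h : (∀ i, 0 < v i) ∨ X.rank = Fintype.card m) : (X * Xᵀ + diagonal v).PosDef := by
  have hX : (X * Xᵀ).PosSemidef := by simpa using posSemidef_self_mul_conjTranspose X
  rcases h with h | h
  · exact PosDef.posSemidef_add hX (PosDef.diagonal h)
  · refine PosDef.add_posSemidef ?_ (PosSemidef.diagonal hv)
    rw [hX.posDef_iff_isUnit, ← mulVec_surjective_iff_isUnit, ← coe_mulVecLin,
      ← LinearMap.range_eq_top]
    exact Submodule.eq_top_of_finrank_eq
      (((rank_self_mul_transpose X).trans h).trans (Module.finrank_fintype_fun_eq_card ℝ).symm)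

end RankOne

/-! ## Removal weights -/

variable {d n : ℕ} {X : Matrix (Fin d) (Fin n) ℝ} {lam : ℝ} {S : Finset (Fin n)} {i j : Fin n}

/-- The regularized Gram matrix `X_S X_Sᵀ + lam I`, whose determinant is `regDet X lam S`. -/
noncomputable def regGram (X : Matrix (Fin d) (Fin n) ℝ) (lam : ℝ) (S : Finset (Fin n)) :
    Matrix (Fin d) (Fin d) ℝ :=
  cols X S * (cols X S)ᵀ + lam • (1 : Matrix (Fin d) (Fin d) ℝ)

theorem regGram_eq_sum (X : Matrix (Fin d) (Fin n) ℝ) (lam : ℝ) (S : Finset (Fin n)) :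
    regGram X lam S = ∑ i ∈ S, vecMulVec (X.col i) (X.col i) + lam • 1 := by
  ext a b
  simp only [regGram, cols, Matrix.add_apply, Matrix.mul_apply, Matrix.sum_apply, vecMulVec_apply,
    submatrix_apply, transpose_apply, id, col_apply]
  rw [Finset.sum_coe_sort S (fun i => X a i * X b i)]

theorem regGram_univ (X : Matrix (Fin d) (Fin n) ℝ) (lam : ℝ) :
    regGram X lam Finset.univ = X * Xᵀ + diagonal fun _ => lam := by
  ext a b
  rw [regGram_eq_sum]
  simp [Matrix.mul_apply, Matrix.sum_apply, vecMulVec_apply, diagonal_apply, one_apply]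

theorem regGram_insert (X : Matrix (Fin d) (Fin n) ℝ) (lam : ℝ) (hi : i ∉ S) :
    regGram X lam (insert i S) = regGram X lam S + vecMulVec (X.col i) (X.col i) := by
  rw [regGram_eq_sum, regGram_eq_sum, Finset.sum_insert hi]
  abel

theorem regGram_erase (X : Matrix (Fin d) (Fin n) ℝ) (lam : ℝ) (hi : i ∈ S) :
    regGram X lam (S.erase i) = regGram X lam S + (-1 : ℝ) • vecMulVec (X.col i) (X.col i) := by
  conv_rhs => rw [← Finset.insert_erase hi, regGram_insert X lam (S.notMem_erase i)]
  rw [neg_one_smul, add_neg_cancel_right]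

theorem posSemidef_regGram (X : Matrix (Fin d) (Fin n) ℝ) (hl : 0 ≤ lam) (S : Finset (Fin n)) :
    (regGram X lam S).PosSemidef := by
  rw [regGram_eq_sum]
  exact (posSemidef_sum S fun i _ => posSemidef_vecMulVec_self _).add (PosSemidef.one.smul hl)

theorem posDef_regGram_of_pos (X : Matrix (Fin d) (Fin n) ℝ) (hl : 0 < lam) (S : Finset (Fin n)) :
    (regGram X lam S).PosDef := by
  rw [regGram_eq_sum]
  exact PosDef.posSemidef_add (posSemidef_sum S fun i _ => posSemidef_vecMulVec_self _)
    (PosDef.one.smul hl)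

theorem removalWeight_eq (hS : (regGram X lam S).PosDef) (hi : i ∈ S) :
    removalWeight X lam S i = 1 - X.col i ⬝ᵥ (regGram X lam S)⁻¹ *ᵥ X.col i := by
  have herase : regDet X lam (S.erase i) = (regGram X lam (S.erase i)).det := rfl
  have hne := hS.det_pos.ne'
  rw [removalWeight, herase, regGram_erase X lam hi, ← smul_vecMulVec, det_add_vecMulVec hne.isUnit,
    show regDet X lam S = (regGram X lam S).det from rfl, mul_div_cancel_left₀ _ hne, mulVec_smul,
    dotProduct_smul, neg_one_smul, ← sub_eq_add_neg]

theorem removalWeight_nonneg (hl : 0 ≤ lam) (S : Finset (Fin n)) (i : Fin n) :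
    0 ≤ removalWeight X lam S i :=
  div_nonneg (posSemidef_regGram X hl _).det_nonneg (posSemidef_regGram X hl _).det_nonneg

theorem removalWeight_le_one (hS : (regGram X lam S).PosDef) (hi : i ∈ S) :
    removalWeight X lam S i ≤ 1 := by
  have hquad := hS.inv.posSemidef.dotProduct_mulVec_nonneg (X.col i)
  rw [star_trivial] at hquad
  rw [removalWeight_eq hS hi]
  linarith

theorem posDef_regGram_erase (hl : 0 ≤ lam) (h : removalWeight X lam S i ≠ 0) :
    (regGram X lam (S.erase i)).PosDef :=
  (posSemidef_regGram X hl _).posDef_iff_det_ne_zero.2 (div_ne_zero_iff.1 h).1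

theorem inv_regGram_erase (hS : (regGram X lam S).PosDef) (hi : i ∈ S)
    (h : removalWeight X lam S i ≠ 0) :
    (regGram X lam (S.erase i))⁻¹ = (regGram X lam S)⁻¹ - (-1 / removalWeight X lam S i) •
      vecMulVec ((regGram X lam S)⁻¹ *ᵥ X.col i) ((regGram X lam S)⁻¹ *ᵥ X.col i) := by
  have hw : 1 + -1 * (X.col i ⬝ᵥ (regGram X lam S)⁻¹ *ᵥ X.col i) = removalWeight X lam S i := by
    rw [removalWeight_eq hS hi]
    ring
  rw [regGram_erase X lam hi, inv_add_smul_vecMulVec_self hS.det_pos.ne'.isUnit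
    (isHermitian_iff_isSymm.1 hS.isHermitian) (by rwa [hw]), hw]

theorem removalWeight_erase (hl : 0 ≤ lam) (hS : (regGram X lam S).PosDef) (hi : i ∈ S)
    (h : removalWeight X lam S i ≠ 0) (hj : j ∈ S.erase i) :
    removalWeight X lam (S.erase i) j = removalWeight X lam S j +
      (-1 / removalWeight X lam S i) * (X.col j ⬝ᵥ (regGram X lam S)⁻¹ *ᵥ X.col i) ^ 2 := by
  rw [removalWeight_eq (posDef_regGram_erase hl h) hj,
    removalWeight_eq hS (Finset.mem_of_mem_erase hj), inv_regGram_erase hS hi h, sub_mulVec,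
    dotProduct_sub, smul_mulVec, dotProduct_smul, vecMulVec_mulVec, op_smul_eq_smul,
    dotProduct_smul, smul_eq_mul, smul_eq_mul, dotProduct_comm _ (X.col j)]
  ring

theorem sum_removalWeight (hS : (regGram X lam S).PosDef) :
    ∑ i ∈ S, removalWeight X lam S i = S.card - d + lam * ((regGram X lam S)⁻¹).trace := by
  have hgram : regGram X lam S - lam • 1 = ∑ i ∈ S, vecMulVec (X.col i) (X.col i) := by
    rw [regGram_eq_sum, add_sub_cancel_right]
  have htrace : ∑ i ∈ S, X.col i ⬝ᵥ (regGram X lam S)⁻¹ *ᵥ X.col i =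
      ((regGram X lam S)⁻¹ * (regGram X lam S - lam • 1)).trace := by
    simp only [hgram, Finset.mul_sum, trace_sum, mul_vecMulVec, trace_vecMulVec, dotProduct_comm]
  rw [Finset.sum_congr rfl fun i hi => removalWeight_eq hS hi, Finset.sum_sub_distrib, htrace,
    mul_sub, nonsing_inv_mul _ hS.det_pos.ne'.isUnit, trace_sub]
  simp only [Finset.sum_const, nsmul_eq_mul, mul_one, trace_one, Fintype.card_fin, mul_smul_one,
    trace_smul, smul_eq_mul]
  ring

theorem card_sub_le_sum_removalWeight (hl : 0 ≤ lam) (hS : (regGram X lam S).PosDef) :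
    (S.card - d : ℝ) ≤ ∑ i ∈ S, removalWeight X lam S i := by
  rw [sum_removalWeight hS]
  exact le_add_of_nonneg_right (mul_nonneg hl hS.inv.posSemidef.trace_nonneg)

theorem sum_removalWeight_pos (hl : 0 ≤ lam) (hS : (regGram X lam S).PosDef)
    (h : 0 < lam ∨ d < S.card) (hne : S.Nonempty) : 0 < ∑ i ∈ S, removalWeight X lam S i := by
  rcases h with h | h
  · exact Finset.sum_pos (fun i _ => div_pos (posDef_regGram_of_pos X h _).det_pos hS.det_pos) hne
  · exact (sub_pos.2 (Nat.cast_lt.2 h)).trans_le (card_sub_le_sum_removalWeight hl hS)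

/-! ## Expectations after further removals -/

/-- The expected value of `f` at the set that `k` further removals lead to from `S`. -/
noncomputable def expectAfter (X : Matrix (Fin d) (Fin n) ℝ) (lam : ℝ)
    (f : Finset (Fin n) → ℝ) : ℕ → Finset (Fin n) → ℝ
  | 0, S => f S
  | k + 1, S => ∑ i ∈ S, removalProb X lam S i * expectAfter X lam f k (S.erase i)

variable {f : Finset (Fin n) → ℝ}

theorem sum_probAfter_succ_mul (f : Finset (Fin n) → ℝ) (k : ℕ) :
    ∑ T, probAfter X lam (k + 1) T * f T =
      ∑ S, probAfter X lam k S * ∑ i ∈ S, removalProb X lam S i * f (S.erase i) := by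
  simp only [probAfter, Finset.mul_sum, Finset.sum_mul]
  rw [Finset.sum_sigma', Finset.sum_sigma']
  refine Finset.sum_bij' (fun x _ => ⟨insert x.2 x.1, x.2⟩) (fun x _ => ⟨x.1.erase x.2, x.2⟩)
    (by simp) (by simp) ?_ ?_ ?_
  · rintro ⟨T, i⟩ h
    simp only [Finset.mem_sigma, Finset.mem_univ, true_and, Finset.mem_compl] at h
    simp [Finset.erase_insert h]
  · rintro ⟨S, i⟩ h
    simp only [Finset.mem_sigma, Finset.mem_univ, true_and] at h
    simp [Finset.insert_erase h]
  · rintro ⟨T, i⟩ h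
    simp only [Finset.mem_sigma, Finset.mem_univ, true_and, Finset.mem_compl] at h
    simp only [Finset.erase_insert h, mul_assoc]

theorem sum_probAfter_mul_expectAfter (f : Finset (Fin n) → ℝ) (k l : ℕ) :
    ∑ S, probAfter X lam k S * expectAfter X lam f l S =
      expectAfter X lam f (k + l) Finset.univ := by
  induction k generalizing l with
  | zero => simp [probAfter]
  | succ k ih => rw [sum_probAfter_succ_mul, add_right_comm, add_assoc, ← ih]; rfl

theorem expectAfter_univ_single (k : ℕ) (T : Finset (Fin n)) :
    expectAfter X lam (Pi.single T 1) k Finset.univ = probAfter X lam k T := by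
  rw [← add_zero k, ← sum_probAfter_mul_expectAfter]
  simp [expectAfter, Pi.single_apply]

theorem sum_removalWeight_mul_expectAfter (hpos : 0 < ∑ i ∈ S, removalWeight X lam S i)
    (f : Finset (Fin n) → ℝ) (k : ℕ) :
    ∑ i ∈ S, removalWeight X lam S i * expectAfter X lam f k (S.erase i) =
      (∑ i ∈ S, removalWeight X lam S i) * expectAfter X lam f (k + 1) S := by
  rw [expectAfter, Finset.mul_sum]
  refine Finset.sum_congr rfl fun i _ => ?_
  rw [removalProb, ← mul_assoc, mul_div_cancel₀ _ hpos.ne']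

theorem removalProb_nonneg (hl : 0 ≤ lam) (S : Finset (Fin n)) (i : Fin n) :
    0 ≤ removalProb X lam S i :=
  div_nonneg (removalWeight_nonneg hl _ _)
    (Finset.sum_nonneg fun _ _ => removalWeight_nonneg hl _ _)

theorem sum_removalProb_le_one (X : Matrix (Fin d) (Fin n) ℝ) (lam : ℝ) (S : Finset (Fin n)) :
    ∑ i ∈ S, removalProb X lam S i ≤ 1 := by
  simp only [removalProb, ← Finset.sum_div]
  exact div_self_le_one _

theorem expectAfter_le_one (hl : 0 ≤ lam) (hf : ∀ T, f T ≤ 1) (k : ℕ) (S : Finset (Fin n)) :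
    expectAfter X lam f k S ≤ 1 := by
  induction k generalizing S with
  | zero => exact hf S
  | succ k ih =>
    refine (Finset.sum_le_sum fun i _ => ?_).trans (sum_removalProb_le_one X lam S)
    exact mul_le_of_le_one_right (removalProb_nonneg hl S i) (ih _)

theorem expectAfter_one {s : ℕ} (hl : 0 ≤ lam) (hds : 0 < lam ∨ d ≤ s) (k : ℕ)
    (hS : (regGram X lam S).PosDef) (hk : S.card = s + k) :
    expectAfter X lam (fun _ => 1) k S = 1 := by
  induction k generalizing S with
  | zero => rfl
  | succ k ih =>
    have hpos : 0 < ∑ i ∈ S, removalWeight X lam S i :=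
      sum_removalWeight_pos hl hS (hds.imp_right fun h => by omega) (Finset.card_pos.1 (by omega))
    refine mul_left_cancel₀ hpos.ne' ?_
    rw [← sum_removalWeight_mul_expectAfter hpos, mul_one]
    refine Finset.sum_congr rfl fun i hi => ?_
    by_cases hw : removalWeight X lam S i = 0
    · rw [hw, zero_mul]
    · rw [ih (posDef_regGram_erase hl hw) (by rw [Finset.card_erase_of_mem hi]; omega), mul_one]

/-- As half of the proposals are accepted on average, a loss `ε` that halves with every removal
shrinks by the factor `3 / 4`. -/
theorem expectAfter_sub_le_sum_accept (hd : 0 < d) (hl : 0 ≤ lam) (hS : (regGram X lam S).PosDef)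
    (hcard : 2 * d ≤ S.card) (f : Finset (Fin n) → ℝ) (k : ℕ) {ε : ℝ} (hε : 0 ≤ ε) :
    expectAfter X lam f (k + 1) S - 3 / 4 * ε ≤
      ∑ i ∈ S, 1 / (S.card : ℝ) *
        (removalWeight X lam S i * (expectAfter X lam f k (S.erase i) - ε / 2) +
          (1 - removalWeight X lam S i) * (expectAfter X lam f (k + 1) S - ε)) := by
  set E := expectAfter X lam f (k + 1) S
  set W := ∑ i ∈ S, removalWeight X lam S i with hW
  have hd' : (0 : ℝ) < d := Nat.cast_pos.2 hd
  have hcard' : (2 * d : ℝ) ≤ S.card := mod_cast hcard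
  have hWge : (S.card - d : ℝ) ≤ W := card_sub_le_sum_removalWeight hl hS
  have hWE := sum_removalWeight_mul_expectAfter (show 0 < W by linarith) f k
  have hhalf : 1 / 2 ≤ W / S.card := by
    rw [div_le_div_iff₀ two_pos (by linarith)]
    linarith
  calc E - 3 / 4 * ε ≤ E - ε + W / S.card * (ε / 2) := by
        linarith [mul_le_mul_of_nonneg_right hhalf (div_nonneg hε zero_le_two)]
    _ = 1 / (S.card : ℝ) * (W * E + (ε / 2 - E) * W + S.card * (E - ε)) := by
        field_simp [show (S.card : ℝ) ≠ 0 by linarith]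
        ring
    _ = _ := by
        rw [← hWE, hW, ← Finset.mul_sum, Finset.mul_sum _ _ (ε / 2 - E), ← nsmul_eq_mul,
          ← Finset.sum_const, ← Finset.sum_add_distrib, ← Finset.sum_add_distrib]
        congr 1
        exact Finset.sum_congr rfl fun i _ => by ring

theorem posDef_regGram_univ (hl : 0 ≤ lam) (hrank : 0 < lam ∨ X.rank = d) :
    (regGram X lam Finset.univ).PosDef := by
  rw [regGram_univ]
  exact posDef_gram_add_diagonal X (fun _ => hl)
    (hrank.imp (fun h _ => h) fun h => h.trans (Fintype.card_fin d).symm)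

theorem sum_regVolProb {s : ℕ} (hs : s ≤ n) (hl : 0 ≤ lam) (hds : 0 < lam ∨ d ≤ s)
    (hrank : 0 < lam ∨ X.rank = d) : ∑ T, regVolProb X lam s T = 1 := by
  rw [← expectAfter_one hl hds (n - s) (posDef_regGram_univ hl hrank) (by simp; omega),
    ← add_zero (n - s), ← sum_probAfter_mul_expectAfter]
  simp [regVolProb, expectAfter]

end VolumeSampling

namespace RealRAM

open Matrix

/-! ## Matrix subroutines -/

/-- The constants held in memory throughout: the dimension `d` in integer register `1`, and the
numbers `1` and `0` in integer registers `4` and `5`. Integer and real registers from `10` on are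
scratch registers. -/
structure Consts (d : ℕ) (σ : State) : Prop where
  dim : σ.nreg 1 = d
  one : σ.nreg 4 = 1
  zero : σ.nreg 5 = 0

theorem Consts.agree {d : ℕ} {σ τ : State} {D : Region} (h : Consts d σ) (hστ : D.Agree σ τ)
    (hD : {1, 4, 5} ⊆ D.nreg) : Consts d τ where
  dim := (hστ.nreg 1 (hD (by simp))).trans h.dim
  one := (hστ.nreg 4 (hD (by simp))).trans h.one
  zero := (hστ.nreg 5 (hD (by simp))).trans h.zero

/-- The matrix in real array `1`. -/
def matOf (d : ℕ) (σ : State) : Matrix (Fin d) (Fin d) ℝ :=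
  Matrix.of fun a b => σ.rarr 1 a b

/-- The column with index `j` of the matrix in real array `0`. -/
def colOf (d : ℕ) (σ : State) (j : ℕ) : Fin d → ℝ :=
  fun a => σ.rarr 0 a j

/-- The vector in the zeroth column of real array `3`. -/
def vecOf (d : ℕ) (σ : State) : Fin d → ℝ :=
  fun a => σ.rarr 3 a 0

/-- Real register `12` receives the sum, over all values of integer register `11` below the
dimension, of the products of the entries `A[i][j]` and `B[k][l]`, where `i`, `j`, `k` and `l` are
integer registers. -/
def dotProg (A i j B k l : ℕ) : Prog :=
  .seq (.op (.rconst 12 0)) (forProg 11 1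
    (block [.rload 10 A i j, .rload 11 B k l, .rmul 10 10 11, .radd 12 12 10]))

theorem ensures_dotProg {d : ℕ} {σ : State} (hσ : Consts d σ) (A i j B k l : ℕ) :
    Ensures (dotProg A i j B k l) σ (12 * d + 5) fun τ => τ.rreg 12 = ∑ m ∈ Finset.range d,
      σ.rarr A ((σ.setN 11 m).nreg i) ((σ.setN 11 m).nreg j) *
        σ.rarr B ((σ.setN 11 m).nreg k) ((σ.setN 11 m).nreg l) := by
  refine (Ensures.seq (P := (· = σ.setR 12 0)) (l := d * 12 + 3) (.op (o := .rconst 12 0) trivial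
    (by simp [Instr.det])) ?_).mono (le_of_eq (by ring)) fun _ => id
  rintro _ rfl
  refine (Ensures.forProg (σ := σ.setR 12 0) (D := ⟨{11}ᶜ, ∅, ∅, Set.univ⟩) (k := 9)
    (fun m τ => τ.rreg 12 = ∑ m ∈ Finset.range m,
      σ.rarr A ((σ.setN 11 m).nreg i) ((σ.setN 11 m).nreg j) *
        σ.rarr B ((σ.setN 11 m).nreg k) ((σ.setN 11 m).nreg l))
    (by simp [Prog.Preserves, Instr.Preserves, block, Region.insertNReg]) (by simp) (by simp)
    (by simp) hσ.dim hσ.one (by simp) (by simp) fun m τ _ hστ hm hsum => ?_).mono le_rfl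
      fun _ h => h.2
  have hnreg : τ.nreg = (σ.setN 11 m).nreg := by
    ext a
    by_cases ha : a = 11
    · simp [ha, hm]
    · simp [ha, hστ.nreg a ha]
  have hrarr (A : ℕ) : τ.rarr A = σ.rarr A := hστ.rarr A (Set.mem_univ A)
  exact Ensures.block (by simp [Instr.IsDet])
    (by simp [execs, Instr.det, Finset.sum_range_succ, hsum, hnreg, hrarr])

/-- Real register `12` receives the inner product of the vector in real array `3` with the column
whose index is in integer register `8`. -/
def colDotProg : Prog :=
  dotProg 0 11 8 3 11 5

theorem ensures_colDotProg {d : ℕ} {σ : State} (hσ : Consts d σ) :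
    Ensures colDotProg σ (12 * d + 5) fun τ => τ.rreg 12 = colOf d σ (σ.nreg 8) ⬝ᵥ vecOf d σ :=
  (ensures_dotProg hσ _ _ _ _ _ _).mono le_rfl fun τ hτ => by
    simp [hτ, Finset.sum_range, hσ.zero, dotProduct, colOf, vecOf]

/-- Real array `3` receives the product of the matrix in real array `1` with the column whose index
is in integer register `8`. -/
def mulColProg : Prog :=
  forProg 10 1 (.seq (dotProg 1 10 11 0 11 8) (.op (.rstore 3 10 5 12)))

theorem ensures_mulColProg {d : ℕ} {σ : State} (hσ : Consts d σ) :
    Ensures mulColProg σ (d * (12 * d + 10) + 3) fun τ =>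
      vecOf d τ = matOf d σ *ᵥ colOf d σ (σ.nreg 8) := by
  let w (a : ℕ) : ℝ := ∑ m ∈ Finset.range d, σ.rarr 1 a m * σ.rarr 0 m (σ.nreg 8)
  refine (Ensures.forProg (D := ⟨{1, 4, 5, 8}, ∅, ∅, {0, 1}⟩) (k := 12 * d + 7)
    (fun i τ => ∀ a < i, τ.rarr 3 a 0 = w a)
    (by simp [Prog.Preserves, Instr.Preserves, block, dotProg, forProg, Region.insertNReg])
    (by simp) (by simp) (by simp) hσ.dim hσ.one (by simp) (by simp)
    fun i τ _ hστ hi hw => ?_).mono le_rfl fun τ hτ => ?_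
  · refine ((ensures_dotProg (hσ.agree hστ (by simp [Set.insert_subset_iff])) _ _ _ _ _ _).frame
      (D := ⟨{5, 8, 10}, ∅, ∅, {3}⟩)
      (by simp [Prog.Preserves, Instr.Preserves, block, dotProg, forProg])).seq (l := 1)
      fun υ ⟨hτυ, hdot⟩ => .op trivial fun a ha => ?_
    have h5 : υ.nreg 5 = 0 := by simp [hτυ.nreg, hστ.nreg, hσ.zero]
    have h10 : υ.nreg 10 = i := by simp [hτυ.nreg, hi]
    rcases Nat.lt_succ_iff_lt_or_eq.1 ha with ha | rfl
    · simp [Instr.det, h10, ha.ne, hτυ.rarr, hw a ha]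
    · simp [Instr.det, h10, h5, hdot, w, hi, hστ.nreg, hστ.rarr]
  · ext a
    simp [vecOf, hτ.2 a a.2, w, Finset.sum_range, mulVec, dotProduct, matOf, colOf]

/-- Real array `3` receives the product of the matrix in real array `1` with the column whose index
is in integer register `8`, and real register `12` the quadratic form at that column. -/
def quadProg : Prog :=
  .seq mulColProg colDotProg

theorem ensures_quadProg {d : ℕ} {σ : State} (hσ : Consts d σ) (hd : 0 < d) :
    Ensures quadProg σ (50 * d ^ 2) fun τ =>
      vecOf d τ = matOf d σ *ᵥ colOf d σ (σ.nreg 8) ∧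
      τ.rreg 12 = colOf d σ (σ.nreg 8) ⬝ᵥ matOf d σ *ᵥ colOf d σ (σ.nreg 8) := by
  refine (((ensures_mulColProg hσ).frame (D := ⟨{1, 4, 5, 8}, ∅, ∅, {0}⟩)
    (by simp [Prog.Preserves, Instr.Preserves, block, mulColProg, dotProg, forProg])).seq
    fun τ ⟨hστ, hvec⟩ => ((ensures_colDotProg (hσ.agree hστ
      (by simp [Set.insert_subset_iff]))).frame (D := ⟨∅, ∅, ∅, {3}⟩)
      (by simp [Prog.Preserves, Instr.Preserves, block, colDotProg, dotProg, forProg])).mono le_rfl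
      fun υ ⟨hτυ, hdot⟩ => ⟨?_, ?_⟩).mono (by nlinarith) fun _ => id
  · rw [← hvec]
    ext a
    simp [vecOf, hτυ.rarr]
  · have hcol : colOf d τ (τ.nreg 8) = colOf d σ (σ.nreg 8) := by
      ext a
      simp [colOf, hστ.nreg, hστ.rarr]
    rw [hdot, hvec, hcol]

/-- Subtract from the matrix in real array `1` the outer square of the vector in real array `3`
times the content of real register `3`. -/
def updateProg : Prog :=
  forProg 10 1 (forProg 11 1 (block [.rload 10 3 10 5, .rload 11 3 11 5, .rmul 10 10 11,
    .rmul 10 3 10, .rload 11 1 10 11, .rsub 10 11 10, .rstore 1 10 11 10]))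

theorem ensures_updateProg {d : ℕ} {σ : State} (hσ : Consts d σ) (hd : 0 < d) :
    Ensures updateProg σ (50 * d ^ 2) fun τ =>
      matOf d τ = matOf d σ - σ.rreg 3 • vecMulVec (vecOf d σ) (vecOf d σ) := by
  let I (i k : ℕ) (τ : State) : Prop := ∀ a b, b < d → τ.rarr 1 a b =
    if a < i ∨ a = i ∧ b < k then σ.rarr 1 a b - σ.rreg 3 * (σ.rarr 3 a 0 * σ.rarr 3 b 0)
    else σ.rarr 1 a b
  refine (Ensures.forProg (D := ⟨{1, 4, 5}, {3}, ∅, {3}⟩) (k := 18 * d + 3) (fun i => I i 0)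
    (by simp [Prog.Preserves, Instr.Preserves, block, forProg, Region.insertNReg])
    (by simp) (by simp) (by simp) hσ.dim hσ.one (by simp [I]) (by simp [I])
    fun i τ _ hστ hi hI => ?_).mono (by nlinarith) fun τ hτ => ?_
  · refine (Ensures.forProg (D := ⟨{1, 4, 5, 10}, {3}, ∅, {3}⟩) (N := d) (k := 15) (I i)
      (by simp [Prog.Preserves, Instr.Preserves, block, Region.insertNReg])
      (by simp) (by simp) (by simp) (by simp [hστ.nreg, hσ.dim]) (by simp [hστ.nreg, hσ.one])
      (by simp [I]) hI fun k υ hk hτυ hk11 hI => Ensures.block (by simp [Instr.IsDet])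
        fun a b hb => ?_).mono (le_of_eq (by ring)) fun υ hυ a b hb => ?_
    · have h5 : υ.nreg 5 = 0 := by simp [hτυ.nreg, hστ.nreg, hσ.zero]
      have h10 : υ.nreg 10 = i := by simp [hτυ.nreg, hi]
      by_cases hab : a = i ∧ b = k
      · obtain ⟨rfl, rfl⟩ := hab
        simp [execs, Instr.det, h5, h10, hk11, hτυ.rreg, hτυ.rarr, hστ.rreg, hστ.rarr, hI a b hb]
      · have hdone : a < i ∨ a = i ∧ b < k + 1 ↔ a < i ∨ a = i ∧ b < k := by omega
        simp only [hdone, ← hI a b hb]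
        simp [execs, Instr.det, h10, hk11, hab]
    · have hdone : a < i ∨ a = i ∧ b < d ↔ a < i + 1 ∨ a = i + 1 ∧ b < 0 := by omega
      simp only [hυ.2 a b hb, hdone]
  · ext a b
    simp [matOf, hτ.2 a b b.2, vecOf, vecMulVec_apply]

end RealRAM

namespace RealRAM

open Matrix VolumeSampling

variable {d n s : ℕ} {X : Matrix (Fin d) (Fin n) ℝ} {lam : ℝ} {S : Finset (Fin n)} {i : Fin n}
  {a : ℕ → ℕ} {p : ℕ} {σ τ : State}

/-! ## Sets represented by arrays -/

/-- The first `S.card` entries of `a` list the elements of `S`. -/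
def Lists (a : ℕ → ℕ) (S : Finset (Fin n)) : Prop :=
  (Finset.range S.card).image a = S.map Fin.valEmbedding

namespace Lists

theorem injOn (h : Lists a S) : Set.InjOn a (Finset.range S.card) := by
  rw [← Finset.card_image_iff, h, Finset.card_map, Finset.card_range]

theorem exists_mem (h : Lists a S) (hp : p < S.card) : ∃ i ∈ S, a p = i := by
  have hmem : a p ∈ S.map Fin.valEmbedding :=
    h ▸ Finset.mem_image_of_mem _ (Finset.mem_range.2 hp)
  obtain ⟨i, hi, hip⟩ := Finset.mem_map.1 hmem
  exact ⟨i, hi, hip.symm⟩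

theorem exists_index (h : Lists a S) (hi : i ∈ S) : ∃ p < S.card, a p = i := by
  have hmem : (i : ℕ) ∈ (Finset.range S.card).image a :=
    h ▸ Finset.mem_map_of_mem Fin.valEmbedding hi
  simpa using hmem

theorem sum_eq (h : Lists a S) (f : ℕ → ℝ) :
    ∑ p ∈ Finset.range S.card, f (a p) = ∑ i ∈ S, f i := by
  rw [← Finset.sum_image h.injOn, h, Finset.sum_map]
  rfl

theorem samples {P : ℕ → State → Prop} {R : Fin n → State → Prop} {q : Prog} {k : ℕ} {w : ℕ → ℝ}
    {v : Fin n → ℝ} (h : Lists a S) (hq : Samples q σ k (Finset.range S.card) w P)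
    (hwP : ∀ l < S.card, ∀ i ∈ S, a l = i → w l = v i ∧ ∀ τ, P l τ → R i τ) :
    Samples q σ k S v R := fun Q t K x hx => by
  let x' : ℕ → ℝ := Function.extend Fin.val x 0
  let y : ℕ → ℝ := Function.extend Fin.val (fun i => v i * x i) 0
  have hx' (i : Fin n) : x' i = x i := Fin.val_injective.extend_apply _ _ i
  have hy (i : Fin n) : y i = v i * x i := Fin.val_injective.extend_apply _ _ i
  calc ∑ i ∈ S, v i * x i
      = ∑ l ∈ Finset.range S.card, y (a l) := by simp_rw [h.sum_eq y, hy]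
    _ = ∑ l ∈ Finset.range S.card, w l * x' (a l) := Finset.sum_congr rfl fun l hl => by
        obtain ⟨i, hi, hli⟩ := h.exists_mem (Finset.mem_range.1 hl)
        rw [hli, hx', hy, (hwP l (Finset.mem_range.1 hl) i hi hli).1]
    _ ≤ contProb Q (t + k) (q :: K) σ := hq Q t K _ fun l hl τ hτ => by
        obtain ⟨i, hi, hli⟩ := h.exists_mem (Finset.mem_range.1 hl)
        rw [hli, hx']
        exact hx i hi τ ((hwP l (Finset.mem_range.1 hl) i hi hli).2 τ hτ)

theorem erase {b : ℕ → ℕ} (h : Lists a S) (hp : p < S.card) (hi : a p = i)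
    (hb : ∀ l, b l = if l = p then a (S.card - 1) else a l) : Lists b (S.erase i) := by
  have hiS : i ∈ S := by
    obtain ⟨j, hj, hpj⟩ := h.exists_mem hp
    rwa [show i = j from Fin.ext (hi.symm.trans hpj)]
  have hother : ∀ q < S.card, q ≠ p → ∃ j, (j ≠ i ∧ j ∈ S) ∧ (j : ℕ) = a q := by
    intro q hq hqp
    obtain ⟨j, hj, hqj⟩ := h.exists_mem hq
    refine ⟨j, ⟨?_, hj⟩, hqj.symm⟩
    rintro rfl
    exact hqp (h.injOn (by simpa using hq) (by simpa using hp) (hqj.trans hi.symm))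
  rw [Lists, Finset.card_erase_of_mem hiS]
  ext x
  simp only [Finset.mem_image, Finset.mem_range, Finset.mem_map, Finset.mem_erase,
    Fin.valEmbedding_apply]
  constructor
  · rintro ⟨l, hl, rfl⟩
    rw [hb]
    split_ifs with hlp
    · exact hother _ (by omega) (by omega)
    · exact hother _ (by omega) hlp
  · rintro ⟨j, ⟨hji, hj⟩, rfl⟩
    obtain ⟨l, hl, hlj⟩ := h.exists_index hj
    have hlp : l ≠ p := by
      rintro rfl
      exact hji (Fin.ext (hlj.symm.trans hi))
    by_cases hlast : l = S.card - 1
    · exact ⟨p, by omega, by rw [hb, if_pos rfl, ← hlast, hlj]⟩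
    · exact ⟨l, by omega, by rw [hb, if_neg hlp, hlj]⟩

end Lists

/-! ## Removal of an element -/

/-- The memory holds the current set `S`: integer array `0` lists it, integer register `3` holds its
size, and real array `1` holds the inverse of `X_S X_Sᵀ + lam I`. Integer register `6` holds the
size below which the sampler switches from rejection to exact sampling. -/
structure Stores (X : Matrix (Fin d) (Fin n) ℝ) (lam : ℝ) (s : ℕ) (S : Finset (Fin n))
    (σ : State) : Prop extends Consts d σ where
  target : σ.nreg 2 = s
  card : σ.nreg 3 = S.card
  threshold : σ.nreg 6 = max s (2 * d)
  rone : σ.rreg 1 = 1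
  lists : Lists (σ.narr 0) S
  cols : ∀ i : Fin n, colOf d σ i = X.col i
  mat : matOf d σ = (regGram X lam S)⁻¹

/-- The part of the memory that `Stores` refers to. -/
def storeRegion : Region :=
  ⟨Set.Iio 7, {1}, {0}, {0, 1}⟩

theorem Stores.agree (h : Stores X lam s S σ) (hστ : storeRegion.Agree σ τ) :
    Stores X lam s S τ where
  toConsts := h.toConsts.agree hστ (by simp [storeRegion, Set.insert_subset_iff])
  target := (hστ.nreg 2 (by simp [storeRegion])).trans h.target
  card := (hστ.nreg 3 (by simp [storeRegion])).trans h.card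
  threshold := (hστ.nreg 6 (by simp [storeRegion])).trans h.threshold
  rone := (hστ.rreg 1 (by simp [storeRegion])).trans h.rone
  lists := by
    rw [hστ.narr 0 (by simp [storeRegion])]
    exact h.lists
  cols i := by
    rw [← h.cols i]
    ext a
    simp [colOf, hστ.rarr 0 (by simp [storeRegion])]
  mat := by
    rw [← h.mat]
    ext a b
    simp [matOf, hστ.rarr 1 (by simp [storeRegion])]

theorem Stores.setN (h : Stores X lam s S σ) {a : ℕ} (ha : 7 ≤ a) (v : ℕ) :
    Stores X lam s S (σ.setN a v) :=
  h.agree ((Region.Agree.refl σ).setN (by simpa [storeRegion] using ha) v)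

theorem Stores.ensures {p : Prog} {k : ℕ} {P : State → Prop} (h : Stores X lam s S σ)
    (hp : p.Preserves storeRegion) (he : Ensures p σ k P) :
    Ensures p σ k fun τ => Stores X lam s S τ ∧ P τ :=
  (he.frame hp).mono le_rfl fun _ hτ => ⟨h.agree hτ.1, hτ.2⟩

theorem Stores.output (h : Stores X lam s S σ) (hs : S.card = s) : output n s σ = S := by
  have hlists : (Finset.range s).image (σ.narr 0) = S.map Fin.valEmbedding := hs ▸ h.lists
  ext j
  simp only [RealRAM.output, hlists, Finset.mem_filter_univ, Finset.mem_map,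
    Fin.valEmbedding_apply, Fin.val_inj, exists_eq_right]

/-- Integer register `7` holds the position of `i` in the list of the elements of `S`. -/
structure Selects (S : Finset (Fin n)) (i : Fin n) (σ : State) : Prop where
  lt_card : σ.nreg 7 < S.card
  entry : σ.narr 0 (σ.nreg 7) = i

/-- For the element `i` selected by integer register `7`, integer register `8` holds its index, real
array `3` the vector `(X_S X_Sᵀ + lam I)⁻¹ xᵢ`, and real register `10` its removal weight. -/
structure Weighed (X : Matrix (Fin d) (Fin n) ℝ) (lam : ℝ) (S : Finset (Fin n)) (i : Fin n)
    (σ : State) : Prop extends Selects S i σ where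
  index : σ.nreg 8 = i
  vec : vecOf d σ = (regGram X lam S)⁻¹ *ᵥ X.col i
  weight : σ.rreg 10 = removalWeight X lam S i

theorem Weighed.setN (h : Weighed X lam S i σ) {a : ℕ} (ha : 8 < a) (v : ℕ) :
    Weighed X lam S i (σ.setN a v) where
  lt_card := by simpa [show 7 ≠ a by omega] using h.lt_card
  entry := by simpa [show 7 ≠ a by omega] using h.entry
  index := by simpa [show 8 ≠ a by omega] using h.index
  vec := h.vec
  weight := h.weight

/-- Compute the data `Weighed` for the selected element. -/
def weighProg : Prog :=
  .seq (block [.nload 8 0 7]) (.seq quadProg (block [.rsub 10 1 12]))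

theorem ensures_weighProg (h : Stores X lam s S σ) (hi : Selects S i σ) (hd : 0 < d)
    (hS : (regGram X lam S).PosDef) (hiS : i ∈ S) :
    Ensures weighProg σ (60 * d ^ 2) fun τ => Stores X lam s S τ ∧ Weighed X lam S i τ := by
  have hd2 : 1 ≤ d ^ 2 := Nat.one_le_pow _ _ hd
  have hσ₁ : Stores X lam s S (execs [.nload 8 0 7] σ) := h.setN (by norm_num) _
  refine (hσ₁.ensures (by simp [Prog.Preserves, Instr.Preserves, storeRegion, quadProg, mulColProg,
    colDotProg, dotProg, forProg, block]) ((ensures_quadProg hσ₁.toConsts hd).frame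
    (D := ⟨{7, 8}, ∅, {0}, ∅⟩) (by simp [Prog.Preserves, Instr.Preserves, quadProg, mulColProg,
      colDotProg, dotProg, forProg, block]))).seq (l := 3) ?_ |> Ensures.block_seq
    (by simp [Instr.IsDet]) |>.mono (by simp; omega) fun _ => id
  rintro υ ⟨hυ, hσυ, hvec, hquad⟩
  have h7 : υ.nreg 7 = σ.nreg 7 := by simp [hσυ.nreg, execs, Instr.det]
  have h8 : υ.nreg 8 = i := by simp [hσυ.nreg, execs, Instr.det, hi.entry]
  have hnarr : υ.narr 0 = σ.narr 0 := hσυ.narr 0 rfl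
  have hcol : colOf d (execs [.nload 8 0 7] σ) ((execs [.nload 8 0 7] σ).nreg 8) = X.col i := by
    rw [← hσ₁.cols i]
    simp [execs, Instr.det, hi.entry]
  rw [hσ₁.mat, hcol] at hvec hquad
  refine .block (by simp [Instr.IsDet]) ⟨hυ.agree ?_, ⟨?_, ?_⟩, h8, hvec, ?_⟩
  · exact (Region.Agree.refl υ).setR (by simp [storeRegion]) _
  · simpa [execs, Instr.det, h7] using hi.lt_card
  · simpa [execs, Instr.det, h7, hnarr] using hi.entry
  · simp [execs, Instr.det, hυ.rone, hquad, removalWeight_eq hS hiS]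

/-- Remove the selected element, which has been weighed. -/
def removeProg : Prog :=
  .seq (block [.rconst 11 (-1), .rdiv 3 11 10])
    (.seq updateProg (block [.nsub 3 3 4, .nload 12 0 3, .nstore 0 7 12]))

theorem ensures_removeProg (h : Stores X lam s S σ) (hi : Weighed X lam S i σ) (hd : 0 < d)
    (hS : (regGram X lam S).PosDef) (hiS : i ∈ S) (hw : removalWeight X lam S i ≠ 0) :
    Ensures removeProg σ (70 * d ^ 2) fun τ =>
      Stores X lam s (S.erase i) τ ∧ τ.rreg 3 = -1 / removalWeight X lam S i := by
  have hd2 : 1 ≤ d ^ 2 := Nat.one_le_pow _ _ hd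
  set σ₁ := execs [.rconst 11 (-1), .rdiv 3 11 10] σ with hσ₁
  have hD : storeRegion.Agree σ σ₁ :=
    ((Region.Agree.refl σ).setR (by simp [storeRegion]) _).setR (by simp [storeRegion]) _
  have h₁ : Stores X lam s S σ₁ := h.agree hD
  have h3 : σ₁.rreg 3 = -1 / removalWeight X lam S i := by
    simp [hσ₁, execs, Instr.det, hi.weight]
  have hvec : vecOf d σ₁ = vecOf d σ := rfl
  refine ((ensures_updateProg h₁.toConsts hd).frame (D := ⟨Set.Iio 8, {1, 3}, {0}, {0}⟩)
    (by simp [Prog.Preserves, Instr.Preserves, updateProg, forProg, block])).seq (l := 7) ?_ |>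
    Ensures.block_seq (by simp [Instr.IsDet]) |>.mono (by simp; omega) fun _ => id
  rintro υ ⟨hυ, hmat⟩
  have h4 : υ.nreg 4 = 1 := by simp [hυ.nreg, h₁.one]
  have hcard : υ.nreg 3 = S.card := by simp [hυ.nreg, h₁.card]
  have h7 : υ.nreg 7 = σ.nreg 7 := by simp [hυ.nreg, hσ₁, execs, Instr.det]
  have hnarr : υ.narr 0 = σ.narr 0 := hυ.narr 0 rfl
  refine .block (by simp [Instr.IsDet]) ⟨⟨⟨?_, ?_, ?_⟩, ?_, ?_, ?_, ?_, ?_, fun j => ?_, ?_⟩, ?_⟩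
  · simp [execs, Instr.det, hυ.nreg, h₁.dim]
  · simp [execs, Instr.det, hυ.nreg, h₁.one]
  · simp [execs, Instr.det, hυ.nreg, h₁.zero]
  · simp [execs, Instr.det, hυ.nreg, h₁.target]
  · simp [execs, Instr.det, hcard, h4, Finset.card_erase_of_mem hiS]
  · simp [execs, Instr.det, hυ.nreg, h₁.threshold]
  · simp [execs, Instr.det, hυ.rreg, h₁.rone]
  · exact h.lists.erase hi.lt_card hi.entry fun l => by
      simp [execs, Instr.det, h7, hcard, h4, hnarr]
  · rw [← h₁.cols j]
    ext a
    simp [colOf, execs, Instr.det, hυ.rarr]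
  · rw [inv_regGram_erase hS hiS hw, ← hi.vec, ← hvec, ← h₁.mat, ← h3]
    exact hmat
  · simp [execs, Instr.det, hυ.rreg, h3]

/-! ## Removal by rejection sampling -/

theorem samples_unif_selects (h : Stores X lam s S σ) (hne : S.Nonempty) :
    Samples (.op (.unif 7 3)) σ 1 S (fun _ => 1 / (S.card : ℝ)) fun i τ =>
      Stores X lam s S τ ∧ Selects S i τ :=
  h.lists.samples (Samples.unif h.card (Finset.card_pos.2 hne) 7) fun l hl i _ hli =>
    ⟨rfl, by rintro _ rfl; exact ⟨h.setN le_rfl l, by simpa using hl, by simpa using hli⟩⟩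

/-- Propose a uniform element of the current set, and remove it with probability its removal
weight. -/
def trialProg : Prog :=
  .seq (.op (.unif 7 3)) (.seq weighProg
    (.seq (.op (.flip 12 10)) (.cond (.nlt 5 12) removeProg .skip)))

theorem samples_trialProg (h : Stores X lam s S σ) (hd : 0 < d) (hl : 0 ≤ lam)
    (hS : (regGram X lam S).PosDef) (hne : S.Nonempty) :
    Samples trialProg σ (160 * d ^ 2) (S ×ˢ Finset.univ)
      (fun x : Fin n × Bool => 1 / (S.card : ℝ) *
        if x.2 then removalWeight X lam S x.1 else 1 - removalWeight X lam S x.1)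
      fun x τ => Stores X lam s (if x.2 then S.erase x.1 else S) τ ∧
        (x.2 → removalWeight X lam S x.1 ≠ 0) := by
  have hd2 : 1 ≤ d ^ 2 := Nat.one_le_pow _ _ hd
  refine ((samples_unif_selects h hne).seq_prod fun i hiS τ ⟨hτ, hi⟩ => .ensures_seq
    (ensures_weighProg hτ hi hd hS hiS) fun υ ⟨hυ, hwi⟩ => (Samples.flip hwi.weight
      (removalWeight_nonneg hl S i) (removalWeight_le_one hS hiS) 12).and_ne_zero.seq_ensures
      (l := 70 * d ^ 2 + 1) ?_).mono (by omega) fun _ _ _ => id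
  rintro (_ | _) - _ ⟨rfl, hne⟩
  · refine .cond_false (by simp [Test.Holds, hυ.zero]) ((Ensures.skip ?_).mono ?_ fun _ => id)
    · simpa using hυ.setN (by norm_num) 0
    · omega
  · have hw : removalWeight X lam S i ≠ 0 := by simpa using hne
    refine .cond_true (by simp [Test.Holds, hυ.zero]) ((ensures_removeProg (hυ.setN (by norm_num) _)
      (hwi.setN (by norm_num) _) hd hS hiS hw).mono le_rfl fun ω hω => ?_)
    simpa [hw] using hω.1

/-- Rejection sampling until at most `max s (2 * d)` elements are left. -/
def rejectProg : Prog :=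
  .loop (.nlt 6 3) trialProg

theorem le_contProb_rejectProg_of_card_le {Q : State → Prop} {K : List Prog} {B k : ℕ} {x : ℝ}
    (h : Stores X lam s S σ) (hle : S.card ≤ max s (2 * d)) (hx : x ≤ contProb Q B K σ) :
    x ≤ contProb Q (B + 1 + k) (rejectProg :: K) σ := by
  have hexit : ¬ (Test.nlt 6 3).Holds σ := by
    simp only [Test.Holds, h.threshold, h.card]
    omega
  calc x ≤ contProb Q B K σ := hx
    _ = contProb Q (B + 1) (rejectProg :: K) σ :=
        (contProb_succ_of_step (by simp [rejectProg, step, hexit]) B).symm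
    _ ≤ contProb Q (B + 1 + k) (rejectProg :: K) σ := contProb_mono _ _ (by omega)

/-- A bound for the probability that rejection sampling has not finished after `r` trials from `S`.
A trial removes an element, which halves the factor `2 ^ |S|`, with probability at least `1 / 2`, so
it multiplies the expectation of that factor by at most `3 / 4`. -/
noncomputable def rejectLoss (d s r : ℕ) (S : Finset (Fin n)) : ℝ :=
  if S.card ≤ max s (2 * d) then 0 else 2 ^ S.card * (3 / 4) ^ r

theorem rejectLoss_erase_le (d s r : ℕ) (hi : i ∈ S) :
    rejectLoss d s r (S.erase i) ≤ 2 ^ S.card * (3 / 4) ^ r / 2 := by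
  rw [rejectLoss, ← Finset.card_erase_add_one hi, pow_succ]
  split_ifs
  · positivity
  · exact le_of_eq (by ring)

theorem le_contProb_rejectProg_of_trial {f : Finset (Fin n) → ℝ} {Q : State → Prop}
    {K : List Prog} {t k : ℕ} {ε : ℝ} (hd : 0 < d) (hl : 0 ≤ lam) (hS : (regGram X lam S).PosDef)
    (h : Stores X lam s S σ) (hlt : max s (2 * d) < S.card) (hε : 0 ≤ ε)
    (hstay : ∀ τ, Stores X lam s S τ →
      expectAfter X lam f (k + 1) S - ε ≤ contProb Q t (rejectProg :: K) τ)
    (herase : ∀ i ∈ S, removalWeight X lam S i ≠ 0 → ∀ τ, Stores X lam s (S.erase i) τ →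
      expectAfter X lam f k (S.erase i) - ε / 2 ≤ contProb Q t (rejectProg :: K) τ) :
    expectAfter X lam f (k + 1) S - 3 / 4 * ε ≤
      contProb Q (t + 161 * d ^ 2) (rejectProg :: K) σ := by
  have hd2 : 1 ≤ d ^ 2 := Nat.one_le_pow _ _ hd
  have hloop : (Test.nlt 6 3).Holds σ := by simpa [Test.Holds, h.threshold, h.card] using hlt
  let x (y : Fin n × Bool) : ℝ :=
    if y.2 then expectAfter X lam f k (S.erase y.1) - ε / 2 else expectAfter X lam f (k + 1) S - ε
  calc expectAfter X lam f (k + 1) S - 3 / 4 * ε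
    _ ≤ _ := expectAfter_sub_le_sum_accept hd hl hS (by omega) f k hε
    _ = ∑ y ∈ S ×ˢ Finset.univ, 1 / (S.card : ℝ) *
          (if y.2 then removalWeight X lam S y.1 else 1 - removalWeight X lam S y.1) * x y := by
        rw [Finset.sum_product]
        refine Finset.sum_congr rfl fun i _ => ?_
        simp [x, mul_add, mul_assoc]
    _ ≤ contProb Q (t + 160 * d ^ 2) (trialProg :: rejectProg :: K) σ := by
        refine samples_trialProg h hd hl hS (Finset.card_pos.1 (by omega)) Q _ _ x ?_
        rintro ⟨i, _ | _⟩ hi τ ⟨hτ, hw⟩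
        · exact hstay τ hτ
        · exact herase i (Finset.mem_product.1 hi).1 (hw rfl) τ hτ
    _ = contProb Q (t + 160 * d ^ 2 + 1) (rejectProg :: K) σ :=
        (contProb_loop_true hloop _ _ _).symm
    _ ≤ _ := contProb_mono _ _ (by omega)

theorem le_contProb_rejectProg {f : Finset (Fin n) → ℝ} {Q : State → Prop} {K : List Prog} {B : ℕ}
    (hd : 0 < d) (hl : 0 ≤ lam) (hf : ∀ T, f T ≤ 1)
    (hK : ∀ S σ, (regGram X lam S).PosDef → Stores X lam s S σ → s ≤ S.card →
      S.card ≤ max s (2 * d) → expectAfter X lam f (S.card - s) S ≤ contProb Q B K σ)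
    (r : ℕ) (hS : (regGram X lam S).PosDef) (h : Stores X lam s S σ) (hs : s ≤ S.card) :
    expectAfter X lam f (S.card - s) S - rejectLoss d s r S ≤
      contProb Q (B + 1 + r * (161 * d ^ 2)) (rejectProg :: K) σ := by
  induction r generalizing S σ with
  | zero =>
    rw [rejectLoss]
    split_ifs with hle
    · rw [sub_zero]
      exact le_contProb_rejectProg_of_card_le h hle (hK S σ hS h hs hle)
    · have hexp := expectAfter_le_one (X := X) hl hf (S.card - s) S
      have hpow : (1 : ℝ) ≤ 2 ^ S.card := one_le_pow₀ (by norm_num)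
      refine le_trans ?_ (contProb_nonneg _ _ _)
      simp only [pow_zero, mul_one]
      linarith
  | succ r ih =>
    rw [rejectLoss]
    split_ifs with hle
    · rw [sub_zero]
      exact le_contProb_rejectProg_of_card_le h hle (hK S σ hS h hs hle)
    obtain ⟨k, hk⟩ : ∃ k, S.card - s = k + 1 := ⟨S.card - s - 1, by omega⟩
    have htrial := le_contProb_rejectProg_of_trial (f := f) (Q := Q) (K := K) (k := k)
      (t := B + 1 + r * (161 * d ^ 2)) (ε := 2 ^ S.card * (3 / 4) ^ r) hd hl hS h (by omega)
      (by positivity) (fun τ hτ => ?_) fun i hi hw τ hτ => ?_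
    · rw [hk, add_one_mul, ← add_assoc]
      exact le_of_eq_of_le (by ring) htrial
    · have hstay := ih hS hτ hs
      rwa [rejectLoss, if_neg hle, hk] at hstay
    · have hcard := Finset.card_erase_add_one hi
      have herase := ih (posDef_regGram_erase hl hw) hτ (by omega)
      rw [show (S.erase i).card - s = k by omega] at herase
      exact (sub_le_sub_left (rejectLoss_erase_le d s r hi) _).trans herase

end RealRAM

namespace RealRAM

open Matrix VolumeSampling

variable {d n s : ℕ} {X : Matrix (Fin d) (Fin n) ℝ} {lam : ℝ} {S : Finset (Fin n)}
  {σ τ : State}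

/-! ## Exact sampling from a table of weights -/

/-- Real array `4` holds the removal weights of the elements of `S`. -/
def Scores (X : Matrix (Fin d) (Fin n) ℝ) (lam : ℝ) (S : Finset (Fin n)) (σ : State) : Prop :=
  ∀ i ∈ S, σ.rarr 4 i 0 = removalWeight X lam S i

/-- The position in integer register `9` is chosen, that is copied to integer register `7`, if
integer register `12` is positive; then the next position is considered. -/
def chooseProg : Prog :=
  .seq (.cond (.nlt 5 12) (.op (.ncopy 7 9)) .skip) (.op (.nadd 9 9 4))

theorem ensures_chooseProg (h4 : σ.nreg 4 = 1) (h5 : σ.nreg 5 = 0) {v : Bool}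
    (h12 : σ.nreg 12 = if v then 1 else 0) :
    Ensures chooseProg σ 4 fun τ =>
      τ.nreg 9 = σ.nreg 9 + 1 ∧ τ.nreg 7 = if v then σ.nreg 9 else σ.nreg 7 := by
  have hc : (Test.nlt 5 12).Holds σ ↔ v := by cases v <;> simp [Test.Holds, h5, h12]
  refine Ensures.seq (k := 2) (l := 1)
    (P := (· = if v then σ.setN 7 (σ.nreg 9) else σ)) ?_ ?_
  · cases v
    · exact .cond_false (by simp [hc]) (.skip rfl)
    · exact .cond_true (by simp [hc]) (.op trivial rfl)
  · rintro _ rfl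
    refine .op trivial ?_
    cases v <;> simp [Instr.det, h4]

/-- Consider the position in integer register `9`: real register `4` accumulates the total weight of
the positions considered so far, and the new position replaces the chosen one with probability the
quotient of its weight by that total. -/
def considerProg : Prog :=
  .seq (block [.nload 8 0 9, .rload 10 4 8 5, .radd 4 4 10, .rdiv 10 10 4])
    (.seq (.op (.flip 12 10)) chooseProg)

/-- Choose a position in the list of the current set with probability proportional to the weight
that real array `4` holds for the entry at this position. -/
def drawProg : Prog :=
  .seq (block [.nconst 9 0, .nconst 7 0, .rconst 4 0]) (.loop (.nlt 9 3) considerProg)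

/-- The memory that `drawProg` leaves unchanged. -/
def drawRegion : Region :=
  ⟨Set.Iio 7, {4, 10}ᶜ, Set.univ, Set.univ⟩

/-- The weight that real array `4` holds for the entry at position `l`. -/
def weightAt (σ : State) (l : ℕ) : ℝ :=
  σ.rarr 4 (σ.narr 0 l) 0

/-- The memory when `drawProg`, started from `σ`, has considered the positions below `j` and chosen
position `p`. -/
structure Drawing (σ : State) (j p : ℕ) (τ : State) : Prop where
  agree : drawRegion.Agree σ τ
  counter : τ.nreg 9 = j
  choice : τ.nreg 7 = p
  total : τ.rreg 4 = ∑ l ∈ Finset.range j, weightAt σ l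

theorem weightAt_le_sum {j : ℕ} (hg : ∀ l ≤ j, 0 ≤ weightAt σ l) :
    weightAt σ j ≤ ∑ l ∈ Finset.range (j + 1), weightAt σ l :=
  Finset.single_le_sum (fun l hl => hg l (Finset.mem_range_succ_iff.1 hl))
    (Finset.self_mem_range_succ j)

theorem samples_considerProg {j p : ℕ} (hσ : Consts d σ)
    (hg : ∀ l ≤ j, 0 ≤ weightAt σ l) (h : Drawing σ j p τ) :
    Samples considerProg τ 16 Finset.univ
      (fun v : Bool => if v then weightAt σ j / ∑ l ∈ Finset.range (j + 1), weightAt σ l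
        else 1 - weightAt σ j / ∑ l ∈ Finset.range (j + 1), weightAt σ l)
      fun v => Drawing σ (j + 1) (if v then j else p) := by
  have h4 : τ.nreg 4 = 1 := (h.agree.nreg 4 (by simp [drawRegion])).trans hσ.one
  have h5 : τ.nreg 5 = 0 := (h.agree.nreg 5 (by simp [drawRegion])).trans hσ.zero
  have hj : τ.rarr 4 (τ.narr 0 j) 0 = weightAt σ j := by
    rw [weightAt, h.agree.rarr 4 trivial, h.agree.narr 0 trivial]
  have hle := weightAt_le_sum hg
  have hnonneg : 0 ≤ ∑ l ∈ Finset.range (j + 1), weightAt σ l := (hg j le_rfl).trans hle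
  set υ := execs [.nload 8 0 9, .rload 10 4 8 5, .radd 4 4 10, .rdiv 10 10 4] τ with hυ
  have hυ4 : υ.rreg 4 = ∑ l ∈ Finset.range (j + 1), weightAt σ l := by
    simp [hυ, execs, Instr.det, h.counter, h5, hj, h.total, Finset.sum_range_succ]
  have hυ10 : υ.rreg 10 = weightAt σ j / ∑ l ∈ Finset.range (j + 1), weightAt σ l := by
    simp [hυ, execs, Instr.det, h.counter, h5, hj, h.total, Finset.sum_range_succ]
  have hagree : drawRegion.Agree σ υ :=
    (((h.agree.setN (by simp [drawRegion]) _).setR (by simp [drawRegion]) _).setR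
      (by simp [drawRegion]) _).setR (by simp [drawRegion]) _
  refine (Samples.ensures_seq (P₀ := (· = υ)) (.block (by simp [Instr.IsDet]) rfl) ?_).mono
    (k := 9 + 6 + 1) le_rfl fun _ _ _ => id
  rintro _ rfl
  refine (Samples.flip hυ10 (div_nonneg (hg j le_rfl) hnonneg) (div_le_one_of_le₀ hle hnonneg)
    12).seq_ensures (l := 4) ?_
  rintro v - _ rfl
  refine ((ensures_chooseProg (v := v) ?_ ?_ ?_).frame (D := ⟨Set.Iio 7, Set.univ, Set.univ,
    Set.univ⟩) (by simp [Prog.Preserves, Instr.Preserves, chooseProg])).mono le_rfl ?_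
  · simp [hυ, execs, Instr.det, h4]
  · simp [hυ, execs, Instr.det, h5]
  · simp
  · rintro ω ⟨hω, h9, h7⟩
    refine ⟨(hagree.setN (a := 12) (by simp [drawRegion]) _).trans
      ⟨hω.nreg, fun a _ => hω.rreg a trivial, hω.narr, hω.rarr⟩, ?_, ?_,
      (hω.rreg 4 trivial).trans hυ4⟩
    · simp [h9, hυ, execs, Instr.det, h.counter]
    · simp [h7, hυ, execs, Instr.det, h.counter, h.choice]

theorem samples_drawProg_loop {j p m k : ℕ} (hσ : Consts d σ)
    (hg : ∀ l < m, 0 ≤ weightAt σ l) (hm : σ.nreg 3 = m)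
    (hpos : 0 < ∑ l ∈ Finset.range m, weightAt σ l) (hp : p < m) (hk : j + k = m)
    (h : Drawing σ j p τ) :
    Samples (.loop (.nlt 9 3) considerProg) τ (k * 18 + 1) (Finset.range m)
      (fun q => ((if q = p then 1 else 0) * ∑ l ∈ Finset.range j, weightAt σ l +
        if j ≤ q then weightAt σ q else 0) / ∑ l ∈ Finset.range m, weightAt σ l)
      fun q => Drawing σ m q := by
  have h3 : τ.nreg 3 = m := (h.agree.nreg 3 (by simp [drawRegion])).trans hm
  induction k generalizing j p τ with
  | zero =>
    obtain rfl : j = m := by omega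
    have hexit : ¬ (Test.nlt 9 3).Holds τ := by simp [Test.Holds, h.counter, h3]
    refine (Samples.of_ensures (P₀ := (· = τ)) ⟨τ, 1, le_rfl, .loop_false hexit, rfl⟩
      (Finset.mem_range.2 hp) (by rintro _ rfl; exact h)).congr (fun q hq => ?_) |>.mono
        (by omega) fun _ _ _ => id
    rw [if_neg (Finset.mem_range.1 hq).not_ge]
    by_cases hqp : q = p <;> simp [hqp, hpos.ne']
  | succ k ih =>
    have hloop : (Test.nlt 9 3).Holds τ := by simp [Test.Holds, h.counter, h3]; omega
    refine (Samples.loop_true hloop ((samples_considerProg hσ (fun l hl => hg l (by omega)) h).seq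
      fun v _ υ hυ => ih (by split_ifs <;> omega) (by omega) hυ
        ((hυ.agree.nreg 3 (by simp [drawRegion])).trans hm))).congr (fun q _ => ?_) |>.mono
          (by omega) fun _ _ _ => id
    have hsucc := Finset.sum_range_succ (weightAt σ) j
    have hkeep : weightAt σ j / (∑ l ∈ Finset.range (j + 1), weightAt σ l) *
        ∑ l ∈ Finset.range (j + 1), weightAt σ l = weightAt σ j :=
      div_mul_cancel_of_imp fun h0 => le_antisymm
        ((weightAt_le_sum fun l hl => hg l (by omega)).trans_eq h0) (hg j (by omega))
    rw [Fintype.sum_bool, ← mul_div_assoc, ← mul_div_assoc, ← add_div]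
    congr 1
    have hle : (if j ≤ q then weightAt σ q else 0) =
        (if j + 1 ≤ q then weightAt σ q else 0) + (if q = j then 1 else 0) * weightAt σ j := by
      rcases lt_trichotomy q j with hq | rfl | hq
      · simp [hq.not_ge, hq.ne, show ¬ j + 1 ≤ q by omega]
      · simp
      · simp [hq.le, hq.ne', show j + 1 ≤ q by omega]
    simp only [hle, if_true, Bool.false_eq_true, if_false]
    linear_combination ((if q = j then 1 else 0) - if q = p then 1 else 0) * hkeep +
      (if q = p then 1 else 0) * hsucc

theorem samples_drawProg (h : Stores X lam s S σ) (hg : Scores X lam S σ) (hl : 0 ≤ lam)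
    (hpos : 0 < ∑ i ∈ S, removalWeight X lam S i) :
    Samples drawProg σ (S.card * 18 + 9) S (removalProb X lam S) fun i τ =>
      Stores X lam s S τ ∧ Selects S i τ ∧ τ.rarr 4 = σ.rarr 4 := by
  have hweight (l : ℕ) (i : Fin n) (hi : i ∈ S) (hli : σ.narr 0 l = i) :
      weightAt σ l = removalWeight X lam S i := by rw [weightAt, hli, hg i hi]
  have hsum : ∑ l ∈ Finset.range S.card, weightAt σ l = ∑ i ∈ S, removalWeight X lam S i :=
    (h.lists.sum_eq fun a => σ.rarr 4 a 0).trans (Finset.sum_congr rfl hg)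
  have hstart : Drawing σ 0 0 (execs [.nconst 9 0, .nconst 7 0, .rconst 4 0] σ) :=
    ⟨(((Region.Agree.refl σ).setN (by simp [drawRegion]) _).setN (by simp [drawRegion]) _).setR
      (by simp [drawRegion]) _, by simp [execs, Instr.det], by simp [execs, Instr.det],
      by simp [execs, Instr.det]⟩
  have hnonneg (l : ℕ) (hl' : l < S.card) : 0 ≤ weightAt σ l := by
    obtain ⟨i, hi, hli⟩ := h.lists.exists_mem hl'
    exact (removalWeight_nonneg hl S i).trans_eq (hweight l i hi hli).symm
  have hloop := samples_drawProg_loop h.toConsts hnonneg h.card (hpos.trans_eq hsum.symm)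
    (Finset.card_pos.2 (Finset.nonempty_of_sum_ne_zero hpos.ne')) (zero_add _) hstart
  refine h.lists.samples ((Samples.ensures_seq (P₀ := (· = _)) (.block (by simp [Instr.IsDet]) rfl)
    (by rintro _ rfl; exact hloop)).mono (by simp; omega) fun _ _ _ => id)
      fun l hl i hi hli => ⟨?_, fun τ (hτ : Drawing σ _ l τ) =>
        ⟨h.agree ?_, ⟨?_, ?_⟩, hτ.agree.rarr 4 trivial⟩⟩
  · simp [removalProb, hsum, hweight l i hi hli]
  · exact ⟨hτ.agree.nreg, fun a ha => hτ.agree.rreg a (by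
      rw [Set.mem_singleton_iff.1 ha]; simp [drawRegion]), fun A _ => hτ.agree.narr A trivial,
      fun A _ => hτ.agree.rarr A trivial⟩
  · rwa [hτ.choice]
  · rwa [hτ.choice, hτ.agree.narr 0 trivial]

/-! ## Maintenance of the table of weights -/

/-- Fill real array `4` with the removal weights of the elements of the current set. -/
def scoreProg : Prog :=
  forProg 7 3 (.seq weighProg (.op (.rstore 4 8 5 10)))

theorem ensures_scoreProg (h : Stores X lam s S σ) (hd : 0 < d) (hS : (regGram X lam S).PosDef) :
    Ensures scoreProg σ (S.card * (60 * d ^ 2 + 5) + 3) fun τ =>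
      Stores X lam s S τ ∧ Scores X lam S τ := by
  refine (Ensures.forProg (D := storeRegion) (k := 60 * d ^ 2 + 2)
    (fun l τ => ∀ q < l, ∀ i : Fin n, σ.narr 0 q = i → τ.rarr 4 i 0 = removalWeight X lam S i)
    (by simp [Prog.Preserves, Instr.Preserves, storeRegion, weighProg, quadProg, mulColProg,
      colDotProg, dotProg, forProg, block, Region.insertNReg])
    (by simp [storeRegion]) (by simp [storeRegion]) (by simp [storeRegion]) h.card h.one
    (by simp) (by simp) fun l τ hl hστ h7 hI => ?_).mono le_rfl fun τ hτ => ⟨h.agree hτ.1, ?_⟩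
  · obtain ⟨i, hi, hli⟩ := h.lists.exists_mem hl
    have hτ : Stores X lam s S τ := h.agree hστ
    have hsel : Selects S i τ := ⟨h7 ▸ hl, by rw [h7, hστ.narr 0 rfl, hli]⟩
    refine ((ensures_weighProg hτ hsel hd hS hi).frame (D := ⟨∅, ∅, ∅, {4}⟩) (by
      simp [Prog.Preserves, Instr.Preserves, weighProg, quadProg, mulColProg, colDotProg, dotProg,
        forProg, block])).seq (l := 1) fun υ ⟨hτυ, hυ, hwi⟩ => .op trivial fun q hq j hqj => ?_
    rcases eq_or_ne j i with rfl | hji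
    · simp [Instr.det, hwi.index, hυ.zero, hwi.weight]
    · have hql : q ≠ l := by
        rintro rfl
        exact hji (Fin.ext (hqj.symm.trans hli))
      simp [Instr.det, hwi.index, hυ.zero, Fin.val_inj, hji, hτυ.rarr, hI q (by omega) j hqj]
  · intro i hi
    obtain ⟨l, hl, hli⟩ := h.lists.exists_index hi
    exact hτ.2 l hl i hli

/-- Update the entry of real array `4` for the element at the position in integer register `9`. -/
def refreshEntryProg : Prog :=
  .seq (block [.nload 8 0 9]) (.seq colDotProg (block
    [.rmul 12 12 12, .rmul 12 12 3, .rload 10 4 8 5, .radd 10 10 12, .rstore 4 8 5 10]))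

theorem ensures_refreshEntryProg (hσ : Consts d σ) :
    Ensures refreshEntryProg σ (12 * d + 21) fun τ => ∀ l, τ.rarr 4 l 0 = σ.rarr 4 l 0 +
      if l = σ.narr 0 (σ.nreg 9) then σ.rreg 3 * (colOf d σ l ⬝ᵥ vecOf d σ) ^ 2 else 0 := by
  set j := σ.narr 0 (σ.nreg 9) with hj
  have hσ₁ : Consts d (execs [.nload 8 0 9] σ) := ⟨hσ.dim, hσ.one, hσ.zero⟩
  refine ((ensures_colDotProg hσ₁).frame (D := ⟨{5, 8}, {3}, ∅, {4}⟩) (by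
    simp [Prog.Preserves, Instr.Preserves, colDotProg, dotProg, forProg, block])).seq (l := 11)
    ?_ |> Ensures.block_seq (by simp [Instr.IsDet]) |>.mono (by simp; omega) fun _ => id
  rintro υ ⟨hυ, hdot⟩
  have h8 : υ.nreg 8 = j := by simp [hυ.nreg, execs, Instr.det, hj]
  have h5 : υ.nreg 5 = 0 := by simp [hυ.nreg, hσ₁.zero]
  have h3 : υ.rreg 3 = σ.rreg 3 := hυ.rreg 3 rfl
  have hrarr : υ.rarr 4 = σ.rarr 4 := hυ.rarr 4 rfl
  have hdot' : υ.rreg 12 = colOf d σ j ⬝ᵥ vecOf d σ := by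
    rw [hdot]
    simp [execs, Instr.det, hj]
    rfl
  refine .block (by simp [Instr.IsDet]) fun l => ?_
  rcases eq_or_ne l j with rfl | hlj
  · simp [execs, Instr.det, h8, h5, hdot', h3, hrarr]
    ring
  · simp [execs, Instr.det, h8, h5, hrarr, hlj]

/-- Update real array `4` after a removal. Real register `3` holds the coefficient and real array
`3` the vector of the rank-one update of the inverse matrix. -/
def refreshProg : Prog :=
  forProg 9 3 refreshEntryProg

theorem ensures_refreshProg (h : Stores X lam s S σ) :
    Ensures refreshProg σ (S.card * (12 * d + 24) + 3) fun τ => Stores X lam s S τ ∧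
      ∀ i ∈ S, τ.rarr 4 i 0 = σ.rarr 4 i 0 + σ.rreg 3 * (X.col i ⬝ᵥ vecOf d σ) ^ 2 := by
  refine (Ensures.forProg (D := ⟨Set.Iio 7, {1, 3}, {0}, {0, 1, 3}⟩) (k := 12 * d + 21)
    (fun l τ => ∀ q < S.card, ∀ i : Fin n, σ.narr 0 q = i → τ.rarr 4 i 0 = σ.rarr 4 i 0 +
      if q < l then σ.rreg 3 * (X.col i ⬝ᵥ vecOf d σ) ^ 2 else 0)
    (by simp [Prog.Preserves, Instr.Preserves, refreshEntryProg, colDotProg, dotProg, forProg,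
      block, Region.insertNReg])
    (by simp) (by simp) (by simp) h.card h.one
    (by simp) (by simp) fun l τ hl hστ h9 hI => ?_).mono le_rfl fun τ hτ => ⟨h.agree ?_, ?_⟩
  · refine (ensures_refreshEntryProg (h.toConsts.agree hστ
      (by simp [Set.insert_subset_iff]))).mono le_rfl fun υ hυ q hq i hqi => ?_
    have hvec : vecOf d τ = vecOf d σ := by
      ext a
      simp [vecOf, hστ.rarr]
    have hcol : colOf d τ i = X.col i := by
      rw [← h.cols i]
      ext a
      simp [colOf, hστ.rarr]
    have hiff : (i : ℕ) = σ.narr 0 l ↔ q = l := by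
      rw [← hqi]
      exact h.lists.injOn.eq_iff (by simpa using hq) (by simpa using hl)
    rw [hυ, hI q hq i hqi, hcol, hvec, h9, hστ.narr 0 rfl, hστ.rreg 3 (by simp), add_assoc]
    rcases lt_trichotomy q l with hql | rfl | hql
    · simp [hiff, hql, hql.ne, hql.le]
    · simp [hiff]
    · simp [hiff, hql.ne', hql.not_gt, hql.not_ge]
  · exact ⟨hτ.1.nreg, fun a ha => hτ.1.rreg a (.inl ha), hτ.1.narr, fun A hA => hτ.1.rarr A (by
      rcases hA with rfl | rfl <;> simp)⟩
  · intro i hi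
    obtain ⟨l, hl, hli⟩ := h.lists.exists_index hi
    simp [hτ.2 l hl i hli, hl]

/-- Exact sampling until the size of the current set is the target size, the weights of the elements
being kept in real array `4`. -/
def exactProg : Prog :=
  .loop (.nlt 2 3) (.seq drawProg (.seq weighProg (.seq removeProg refreshProg)))

theorem samples_exactProg_round (h : Stores X lam s S σ) (hg : Scores X lam S σ) (hd : 0 < d)
    (hl : 0 ≤ lam) (hS : (regGram X lam S).PosDef) (hpos : 0 < ∑ i ∈ S, removalWeight X lam S i)
    (hcard : S.card ≤ 2 * d) :
    Samples (.seq drawProg (.seq weighProg (.seq removeProg refreshProg))) σ (300 * d ^ 2) S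
      (removalProb X lam S) fun i τ => i ∈ S ∧ removalWeight X lam S i ≠ 0 ∧
        Stores X lam s (S.erase i) τ ∧ Scores X lam (S.erase i) τ := by
  have hd2 : d ≤ d ^ 2 := Nat.le_self_pow two_ne_zero d
  refine ((samples_drawProg h hg hl hpos).and_ne_zero.seq_ensures
    (l := 60 * d ^ 2 + (70 * d ^ 2 + ((2 * d) * (12 * d + 24) + 3) + 1) + 1)
      fun i hi τ ⟨⟨hτ, hsel, hτ4⟩, hp⟩ => ?_).mono (by nlinarith) fun _ _ _ => id
  have hw : removalWeight X lam S i ≠ 0 := fun h0 => hp (by rw [removalProb, h0, zero_div])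
  refine ((ensures_weighProg hτ hsel hd hS hi).frame (D := ⟨∅, ∅, ∅, {4}⟩) (by
      simp [Prog.Preserves, Instr.Preserves, weighProg, quadProg, mulColProg, colDotProg, dotProg,
        forProg, block])).seq fun υ ⟨hτυ, hυ, hwi⟩ => ?_
  refine ((ensures_removeProg hυ hwi hd hS hi hw).frame (D := ⟨∅, ∅, ∅, {3, 4}⟩) (by
      simp [Prog.Preserves, Instr.Preserves, removeProg, updateProg, forProg, block])).seq
        fun ω ⟨hυω, hω, hω3⟩ => ?_
  have hvec : vecOf d ω = (regGram X lam S)⁻¹ *ᵥ X.col i := by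
    rw [← hwi.vec]
    ext a
    simp [vecOf, hυω.rarr]
  refine (ensures_refreshProg hω).mono ?_ fun ψ ⟨hψ, hψ4⟩ => ⟨hi, hw, hψ, fun j hj => ?_⟩
  · have := Finset.card_erase_le (s := S) (a := i)
    gcongr
    omega
  · rw [hψ4 j hj, hυω.rarr 4 (by simp), hτυ.rarr 4 rfl, hτ4, hg j (Finset.mem_of_mem_erase hj), hω3,
      hvec, removalWeight_erase hl hS hi hw hj]

theorem le_contProb_exactProg {f : Finset (Fin n) → ℝ} {Q : State → Prop} (hd : 0 < d)
    (hl : 0 ≤ lam) (hds : 0 < lam ∨ d ≤ s)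
    (hQ : ∀ S σ, Stores X lam s S σ → S.card = s → f S ≤ contProb Q 0 [] σ) (k : ℕ)
    (hS : (regGram X lam S).PosDef) (h : Stores X lam s S σ) (hg : Scores X lam S σ)
    (hk : S.card = s + k) (hcard : S.card ≤ max s (2 * d)) :
    expectAfter X lam f k S ≤ contProb Q (1 + k * (300 * d ^ 2 + 1)) [exactProg] σ := by
  induction k generalizing S σ with
  | zero =>
    have hexit : ¬ (Test.nlt 2 3).Holds σ := by simp [Test.Holds, h.target, h.card, hk]
    rw [zero_mul, add_zero, ← zero_add 1,
      contProb_succ_of_step (K' := []) (τ := σ) (by simp [exactProg, step, hexit])]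
    exact hQ S σ h hk
  | succ k ih =>
    have hloop : (Test.nlt 2 3).Holds σ := by simp [Test.Holds, h.target, h.card, hk]
    have hpos := sum_removalWeight_pos hl hS (hds.imp_right (by omega))
      (Finset.card_pos.1 (by omega))
    have hround := samples_exactProg_round h hg hd hl hS hpos (by omega) Q
      (1 + k * (300 * d ^ 2 + 1)) [exactProg] (fun i => expectAfter X lam f k (S.erase i))
      fun i hi τ ⟨_, hw, hτ, hτg⟩ => ih (posDef_regGram_erase hl hw) hτ hτg
        (by rw [Finset.card_erase_of_mem hi]; omega) (by rw [Finset.card_erase_of_mem hi]; omega)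
    calc expectAfter X lam f (k + 1) S
        = ∑ i ∈ S, removalProb X lam S i * expectAfter X lam f k (S.erase i) := rfl
      _ ≤ contProb Q (1 + k * (300 * d ^ 2 + 1) + 300 * d ^ 2)
          [.seq drawProg (.seq weighProg (.seq removeProg refreshProg)), exactProg] σ := hround
      _ = contProb Q (1 + k * (300 * d ^ 2 + 1) + 300 * d ^ 2 + 1) [exactProg] σ :=
        (contProb_loop_true hloop _ _ _).symm
      _ = contProb Q (1 + (k + 1) * (300 * d ^ 2 + 1)) [exactProg] σ := by
        congr 1
        ring

end RealRAM

namespace RealRAM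

open Matrix VolumeSampling

variable {d n s : ℕ} {X : Matrix (Fin d) (Fin n) ℝ} {lam : ℝ} {σ τ : State}

/-! ## Initialization -/

/-- Store the unit vectors as the columns following those of the input, and the identity matrix in
real array `1`. -/
def unitProg : Prog :=
  forProg 9 1 (block [.nadd 8 0 9, .rstore 0 9 8 1, .rstore 1 9 9 1])

theorem ensures_unitProg (hσ : Consts d σ) (hnum : σ.nreg 0 = n) (hone : σ.rreg 1 = 1)
    (hX : ∀ i j, n ≤ j → σ.rarr 0 i j = 0) (hM : ∀ i j, σ.rarr 1 i j = 0) :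
    Ensures unitProg σ (d * 10 + 3) fun τ => (∀ j < n, colOf d τ j = colOf d σ j) ∧
      (∀ k : Fin d, colOf d τ (n + k) = Pi.single k 1) ∧ matOf d τ = 1 := by
  refine (Ensures.forProg (D := ⟨{8, 9}ᶜ, Set.univ, ∅, ∅⟩) (k := 7) (fun k τ =>
    (∀ i j, τ.rarr 0 i j = if i < k ∧ j = n + i then 1 else σ.rarr 0 i j) ∧
      ∀ i j, τ.rarr 1 i j = if i < k ∧ j = i then 1 else 0)
    (by simp [Prog.Preserves, Instr.Preserves, block, Region.insertNReg]) (by simp) (by simp)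
    (by simp) hσ.dim hσ.one (by simp) (by simp [hM]) fun k τ _ hστ hk hI => ?_).mono le_rfl
      fun τ ⟨_, hcol, hmat⟩ => ⟨fun j hj => ?_, fun k => ?_, ?_⟩
  · have h0 : τ.nreg 0 = n := by simp [hστ.nreg, hnum]
    have h1 : τ.rreg 1 = 1 := by simp [hστ.rreg, hone]
    refine Ensures.block (by simp [Instr.IsDet]) ⟨fun i j => ?_, fun i j => ?_⟩
    · by_cases hij : i = k ∧ j = n + k
      · simp [execs, Instr.det, hk, h0, h1, hij]
      · have hiff : (i < k + 1 ∧ j = n + i) ↔ (i < k ∧ j = n + i) := by omega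
        simp only [hiff]
        simp [execs, Instr.det, hk, h0, hij, hI.1]
    · by_cases hij : i = k ∧ j = k
      · simp [execs, Instr.det, hk, h1, hij]
      · have hiff : (i < k + 1 ∧ j = i) ↔ (i < k ∧ j = i) := by omega
        simp only [hiff]
        simp [execs, Instr.det, hk, hij, hI.2]
  · ext a
    simp [colOf, hcol, show j ≠ n + a by omega]
  · ext a
    simp [colOf, hcol, hX, Pi.single_apply, Fin.ext_iff, eq_comm]
  · ext a b
    simp [matOf, hmat, one_apply, Fin.ext_iff, eq_comm]

/-- Integer array `0` receives the list `0, 1, …, n - 1`. -/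
def listProg : Prog :=
  forProg 9 0 (.op (.nstore 0 9 9))

theorem ensures_listProg (hσ : Consts d σ) (hnum : σ.nreg 0 = n) :
    Ensures listProg σ (n * 4 + 3) fun τ => Lists (τ.narr 0) (Finset.univ : Finset (Fin n)) := by
  refine (Ensures.forProg (D := ⟨{9}ᶜ, ∅, ∅, ∅⟩) (k := 1) (fun k τ => ∀ l < k, τ.narr 0 l = l)
    (by simp [Prog.Preserves, Instr.Preserves, Region.insertNReg]) (by simp) (by simp)
    (by simp) hnum hσ.one (by simp) (by simp) fun k τ _ _ hk hI => ?_).mono le_rfl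
      fun τ ⟨_, hlist⟩ => ?_
  · refine .op trivial fun l hl => ?_
    rcases Nat.lt_succ_iff_lt_or_eq.1 hl with hl | rfl
    · simp [Instr.det, hk, hl.ne, hI l hl]
    · simp [Instr.det, hk]
  · have hrange : (Finset.range n).image (τ.narr 0) = Finset.range n :=
      (Finset.image_congr fun l hl => hlist l (by simpa using hl)).trans Finset.image_id
    rw [Lists, Finset.card_fin, hrange]
    exact (Fin.map_valEmbedding_univ).trans (Nat.Iio_eq_range n) |>.symm

/-- The memory holds the parameters, the list of all columns, and the columns of the input followed
by the unit vectors. -/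
structure Loaded (X : Matrix (Fin d) (Fin n) ℝ) (lam : ℝ) (s : ℕ) (σ : State) : Prop
    extends Consts d σ where
  num : σ.nreg 0 = n
  size : σ.nreg 2 = s
  reg : σ.rreg 0 = lam
  rone : σ.rreg 1 = 1
  lists : Lists (σ.narr 0) (Finset.univ : Finset (Fin n))
  cols : ∀ i : Fin n, colOf d σ i = X.col i
  unit : ∀ k : Fin d, colOf d σ (n + k) = Pi.single k 1

/-- The part of the memory that `Loaded` refers to. -/
def loadRegion : Region :=
  ⟨{0, 1, 2, 4, 5}, {0, 1}, {0}, {0}⟩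

theorem Loaded.agree (h : Loaded X lam s σ) (hστ : loadRegion.Agree σ τ) : Loaded X lam s τ where
  toConsts := h.toConsts.agree hστ (by simp [loadRegion, Set.insert_subset_iff])
  num := (hστ.nreg 0 (by simp [loadRegion])).trans h.num
  size := (hστ.nreg 2 (by simp [loadRegion])).trans h.size
  reg := (hστ.rreg 0 (by simp [loadRegion])).trans h.reg
  rone := (hστ.rreg 1 (by simp [loadRegion])).trans h.rone
  lists := by
    rw [hστ.narr 0 (by simp [loadRegion])]
    exact h.lists
  cols i := by
    rw [← h.cols i]
    ext a
    simp [colOf, hστ.rarr 0 (by simp [loadRegion])]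
  unit k := by
    rw [← h.unit k]
    ext a
    simp [colOf, hστ.rarr 0 (by simp [loadRegion])]

/-- Bring the input into the form described by `Loaded`, with the identity matrix in real array
`1`. -/
def initProg : Prog :=
  .seq (block [.nconst 4 1, .rconst 1 1]) (.seq unitProg listProg)

theorem ensures_initProg (X : Matrix (Fin d) (Fin n) ℝ) (lam : ℝ) (s : ℕ) :
    Ensures initProg (input X lam s) (10 * d + 4 * n + 13) fun τ =>
      Loaded X lam s τ ∧ matOf d τ = 1 := by
  set σ := execs [.nconst 4 1, .rconst 1 1] (input X lam s) with hσdef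
  have hσ : Consts d σ := ⟨by simp [hσdef, execs, Instr.det, input],
    by simp [hσdef, execs, Instr.det, input], by simp [hσdef, execs, Instr.det, input]⟩
  have hnum : σ.nreg 0 = n := by simp [hσdef, execs, Instr.det, input]
  have hone : σ.rreg 1 = 1 := by simp [hσdef, execs, Instr.det]
  have hX : ∀ i j, n ≤ j → σ.rarr 0 i j = 0 := fun i j hj => by
    simp [hσdef, execs, Instr.det, input, hj.not_gt]
  have hcols : ∀ i : Fin n, colOf d σ i = X.col i := fun i => by
    ext a
    simp [hσdef, execs, Instr.det, input, colOf]
  refine (Ensures.block_seq (by simp [Instr.IsDet]) (((ensures_unitProg hσ hnum hone hX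
    (by simp [hσdef, execs, Instr.det, input])).frame (D := ⟨{0, 1, 2, 4, 5}, {0, 1}, ∅, ∅⟩)
    (by simp [Prog.Preserves, Instr.Preserves, unitProg, forProg, block])).seq
    fun τ ⟨hστ, hcol, hunit, hmat⟩ => ((ensures_listProg (n := n)
      (hσ.agree hστ (by simp [Set.insert_subset_iff])) (by simp [hστ.nreg, hnum])).frame
      (D := ⟨{0, 1, 2, 4, 5}, {0, 1}, ∅, {0, 1}⟩)
      (by simp [Prog.Preserves, Instr.Preserves, listProg, forProg])).mono le_rfl
      fun υ ⟨hτυ, hlists⟩ => ⟨?_, ?_⟩)).mono (by simp; omega) fun _ => id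
  · have hcolυ : ∀ j, colOf d υ j = colOf d τ j := fun j => by
      ext a
      simp [colOf, hτυ.rarr]
    have hsize : σ.nreg 2 = s := by simp [hσdef, execs, Instr.det, input]
    have hreg : σ.rreg 0 = lam := by simp [hσdef, execs, Instr.det, input]
    have hσυ : Region.Agree ⟨{0, 1, 2, 4, 5}, {0, 1}, ∅, ∅⟩ σ υ :=
      hστ.trans ⟨hτυ.nreg, hτυ.rreg, by simp, by simp⟩
    exact {
      toConsts := hσ.agree hσυ (by simp [Set.insert_subset_iff])
      num := (hσυ.nreg 0 (by simp)).trans hnum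
      size := (hσυ.nreg 2 (by simp)).trans hsize
      reg := (hσυ.rreg 0 (by simp)).trans hreg
      rone := (hσυ.rreg 1 (by simp)).trans hone
      lists := hlists
      cols := fun i => (hcolυ i).trans ((hcol i i.2).trans (hcols i))
      unit := fun k => (hcolυ _).trans (hunit k) }
  · rw [← hmat]
    ext a b
    simp [matOf, hτυ.rarr]

/-- Replace the inverse `A⁻¹` of a matrix `A` by the inverse of `A + c v vᵀ`, where `c` is held by
real register `5` and `v` is the column whose index is in integer register `8`. -/
def rankOneProg : Prog :=
  .seq quadProg (.seq (block [.rmul 11 5 12, .radd 11 1 11, .rdiv 3 5 11]) updateProg)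

theorem ensures_rankOneProg (hσ : Consts d σ) (hd : 0 < d) (hone : σ.rreg 1 = 1) {c : ℝ}
    (hc : σ.rreg 5 = c) {v : Fin d → ℝ} (hv : colOf d σ (σ.nreg 8) = v)
    {A : Matrix (Fin d) (Fin d) ℝ} (hA : A.PosDef) (hB : (A + c • vecMulVec v v).PosDef)
    (hmat : matOf d σ = A⁻¹) :
    Ensures rankOneProg σ (120 * d ^ 2) fun τ => matOf d τ = (A + c • vecMulVec v v)⁻¹ := by
  have hd2 : 1 ≤ d ^ 2 := Nat.one_le_pow _ _ hd
  refine (((ensures_quadProg hσ hd).frame (D := ⟨{1, 4, 5}, {1, 5}, ∅, {1}⟩)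
    (by simp [Prog.Preserves, Instr.Preserves, quadProg, mulColProg, colDotProg, dotProg, forProg,
      block])).seq (l := 50 * d ^ 2 + 8) fun τ ⟨hστ, hvec, hquad⟩ => ?_).mono (by omega) fun _ => id
  set υ := execs [.rmul 11 5 12, .radd 11 1 11, .rdiv 3 5 11] τ with hυ
  have hcoeff : υ.rreg 3 = c / (1 + c * (v ⬝ᵥ A⁻¹ *ᵥ v)) := by
    simp [hυ, execs, Instr.det, hστ.rreg, hone, hc, hquad, hv, hmat]
  have hmatυ : matOf d υ = A⁻¹ := by
    rw [← hmat]
    ext a b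
    simp [hυ, execs, Instr.det, matOf, hστ.rarr]
  have hvecυ : vecOf d υ = A⁻¹ *ᵥ v := by
    rw [← hmat, ← hv, ← hvec]
    rfl
  have hconsts : Consts d υ := hσ.agree (D := ⟨{1, 4, 5}, ∅, ∅, ∅⟩)
    ⟨fun a ha => (hστ.nreg a ha), by simp, by simp, by simp⟩ (by simp)
  refine (Ensures.block_seq (by simp [Instr.IsDet]) (ensures_updateProg hconsts hd)).mono
    (by simp; omega) fun ω hω => ?_
  rw [hω, hmatυ, hcoeff, hvecυ, inv_add_smul_vecMulVec_self hA.det_pos.ne'.isUnit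
    (isHermitian_iff_isSymm.1 hA.isHermitian) (one_add_mul_dotProduct_inv_mulVec_pos hA hB).ne']

/-- Perform the update of `rankOneProg` for the columns with indices `m, …, m + N - 1`, where `m`
and `N` are held by the integer registers `z` and `b`. -/
def rankOnesProg (z b : ℕ) : Prog :=
  forProg 9 b (.seq (.op (.nadd 8 z 9)) rankOneProg)

theorem ensures_rankOnesProg (hσ : Consts d σ) (hd : 0 < d) (hone : σ.rreg 1 = 1) {z b m N : ℕ}
    (hz : σ.nreg z = m) (hzreg : z < 8) (hb : σ.nreg b = N) (hbreg : b < 8) {c : ℝ}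
    (hc : σ.rreg 5 = c) {A : ℕ → Matrix (Fin d) (Fin d) ℝ} (hA : ∀ k, (A k).PosDef)
    (hsucc : ∀ k < N, A (k + 1) =
      A k + c • vecMulVec (colOf d σ (m + k)) (colOf d σ (m + k)))
    (hmat : matOf d σ = (A 0)⁻¹) :
    Ensures (rankOnesProg z b) σ (N * (130 * d ^ 2) + 3) fun τ => matOf d τ = (A N)⁻¹ := by
  have hd2 : 1 ≤ d ^ 2 := Nat.one_le_pow _ _ hd
  refine (Ensures.forProg (D := ⟨Set.Iio 8, {1, 5}, ∅, {0}⟩) (k := 120 * d ^ 2 + 2)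
    (fun k τ => matOf d τ = (A k)⁻¹)
    (by simp [Prog.Preserves, Instr.Preserves, rankOneProg, quadProg, mulColProg, colDotProg,
      dotProg, updateProg, forProg, block, Region.insertNReg])
    (by simp) (by simpa) (by simp) hb hσ.one (fun _ _ _ => id) hmat
    fun k τ hkN hστ hk hI => ?_).mono (by gcongr; omega) fun τ hτ => hτ.2
  have hcol : ∀ j, colOf d τ j = colOf d σ j := fun j => by
    ext a
    simp [colOf, hστ.rarr]
  refine (Ensures.seq (P := (· = τ.setN 8 (m + k))) (k := 1) (l := 120 * d ^ 2)
    (.op (o := .nadd 8 z 9) trivial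
    (by simp [Instr.det, hστ.nreg z hzreg, hz, hk])) ?_).mono (by omega) fun _ => id
  rintro _ rfl
  have hB := hA (k + 1)
  rw [hsucc k hkN] at hB ⊢
  exact ensures_rankOneProg ((hσ.agree hστ (by simp [Set.insert_subset_iff])).agree
    ((Region.Agree.refl τ).setN (D := ⟨{8}ᶜ, ∅, ∅, ∅⟩) (by simp) _) (by simp)) hd
    (by simp [hστ.rreg, hone]) (by simp [hστ.rreg, hc])
    ((congrArg _ (by simp)).trans (hcol (m + k))) (hA k) hB hI

/-- Turn the identity matrix into the inverse of `X Xᵀ + I`. -/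
def gramProg : Prog :=
  .seq (.op (.rcopy 5 1)) (rankOnesProg 5 0)

theorem regGram_filter_lt_succ (X : Matrix (Fin d) (Fin n) ℝ) (lam : ℝ) {k : ℕ} (hk : k < n) :
    regGram X lam {i : Fin n | (i : ℕ) < k + 1} = regGram X lam {i : Fin n | (i : ℕ) < k} +
      vecMulVec (X.col ⟨k, hk⟩) (X.col ⟨k, hk⟩) := by
  have hinsert : ({i | (i : ℕ) < k + 1} : Finset (Fin n)) =
      insert ⟨k, hk⟩ ({i | (i : ℕ) < k} : Finset (Fin n)) := by
    ext i
    simp only [Finset.mem_filter_univ, Finset.mem_insert, Fin.ext_iff]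
    omega
  rw [hinsert, regGram_insert X lam (by simp)]

theorem ensures_gramProg (h : Loaded X lam s σ) (hd : 0 < d) (hmat : matOf d σ = 1) :
    Ensures gramProg σ (n * (130 * d ^ 2) + 5) fun τ =>
      matOf d τ = (X * Xᵀ + diagonal fun _ => (1 : ℝ))⁻¹ := by
  have hempty : regGram X 1 {i : Fin n | (i : ℕ) < 0} = 1 := by simp [regGram_eq_sum]
  have huniv : regGram X 1 {i : Fin n | (i : ℕ) < n} = X * Xᵀ + diagonal fun _ => (1 : ℝ) := by
    rw [← regGram_univ]
    simp
  have hτ : Loaded X lam s (σ.setR 5 1) :=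
    h.agree ((Region.Agree.refl σ).setR (by simp [loadRegion]) _)
  refine (Ensures.seq (P := (· = σ.setR 5 1)) (l := n * (130 * d ^ 2) + 3)
    (.op (o := .rcopy 5 1) trivial (by simp [Instr.det, h.rone])) ?_).mono (by omega) fun _ => id
  rintro _ rfl
  rw [← huniv]
  refine ensures_rankOnesProg hτ.toConsts hd hτ.rone hτ.zero (by simp) hτ.num (by simp) (by simp)
    (A := fun k => regGram X 1 {i : Fin n | (i : ℕ) < k})
    (fun k => posDef_regGram_of_pos X one_pos _) (fun k hk => ?_) (c := 1)
    (by rw [hempty, inv_one, ← hmat]; rfl)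
  rw [zero_add, hτ.cols ⟨k, hk⟩, one_smul, regGram_filter_lt_succ X 1 hk]

/-- Change the inverse of `X Xᵀ + I` into the inverse of `X Xᵀ + lam I`. -/
def ridgeProg : Prog :=
  .seq (.op (.rsub 5 0 1)) (rankOnesProg 0 1)

theorem diagonal_ite_lt_succ (lam : ℝ) {k : ℕ} (hk : k < d) :
    (diagonal fun i : Fin d => if (i : ℕ) < k + 1 then lam else 1) =
      (diagonal fun i : Fin d => if (i : ℕ) < k then lam else 1) +
        (lam - 1) • vecMulVec (Pi.single ⟨k, hk⟩ 1) (Pi.single ⟨k, hk⟩ 1) := by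
  rw [← single_eq_single_vecMulVec_single, ← diagonal_single, ← diagonal_smul, diagonal_add]
  congr with i
  rcases lt_trichotomy (i : ℕ) k with hik | rfl | hik
  · simp [hik, hik.trans (Nat.lt_succ_self k), Fin.ext_iff, hik.ne]
  · simp
  · simp [hik.not_gt, (Nat.succ_le_of_lt hik).not_gt, Fin.ext_iff, hik.ne']

theorem ensures_ridgeProg (h : Loaded X lam s σ) (hd : 0 < d) (hl : 0 ≤ lam)
    (hrank : 0 < lam ∨ X.rank = d)
    (hmat : matOf d σ = (X * Xᵀ + diagonal fun _ => (1 : ℝ))⁻¹) :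
    Ensures ridgeProg σ (d * (130 * d ^ 2) + 5) fun τ =>
      matOf d τ = (regGram X lam Finset.univ)⁻¹ := by
  let A (k : ℕ) : Matrix (Fin d) (Fin d) ℝ :=
    X * Xᵀ + diagonal fun i : Fin d => if (i : ℕ) < k then lam else 1
  have hA : ∀ k, (A k).PosDef := fun k => posDef_gram_add_diagonal X
    (fun i => by split_ifs <;> [exact hl; exact zero_le_one])
    (hrank.imp (fun hlam i => by split_ifs <;> [exact hlam; exact one_pos])
      fun hX => by rw [hX, Fintype.card_fin])
  have hlast : regGram X lam Finset.univ = A d := by simp [A, regGram_univ]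
  have hτ : Loaded X lam s (σ.setR 5 (lam - 1)) :=
    h.agree ((Region.Agree.refl σ).setR (by simp [loadRegion]) _)
  refine (Ensures.seq (P := (· = σ.setR 5 (lam - 1))) (l := d * (130 * d ^ 2) + 3)
    (.op (o := .rsub 5 0 1) trivial (by simp [Instr.det, h.reg, h.rone])) ?_).mono (by omega)
      fun _ => id
  rintro _ rfl
  rw [hlast]
  refine ensures_rankOnesProg hτ.toConsts hd hτ.rone hτ.num (by simp) hτ.dim (by simp) (by simp)
    (A := A) hA (fun k hk => ?_) (c := lam - 1)
    (by simp only [A, not_lt_zero, if_false]; exact hmat)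
  rw [hτ.unit ⟨k, hk⟩, add_assoc, ← diagonal_ite_lt_succ lam hk]

/-- Store the size of the initial set and the size `max s (2 * d)` below which sampling is
exact. -/
def thresholdProg : Prog :=
  .seq (block [.ncopy 3 0, .nadd 6 1 1]) (.cond (.nlt 6 2) (.op (.ncopy 6 2)) .skip)

theorem ensures_thresholdProg (h : Loaded X lam s σ) :
    Ensures thresholdProg σ 8 fun τ => τ.nreg 3 = n ∧ τ.nreg 6 = max s (2 * d) := by
  set τ := execs [.ncopy 3 0, .nadd 6 1 1] σ with hτ
  have h2 : τ.nreg 2 = s := by simp [hτ, execs, Instr.det, h.size]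
  have h3 : τ.nreg 3 = n := by simp [hτ, execs, Instr.det, h.num]
  have h6 : τ.nreg 6 = 2 * d := by simp [hτ, execs, Instr.det, h.dim, two_mul]
  refine Ensures.block_seq (k := 2) (by simp [Instr.IsDet]) ?_
  rcases lt_or_ge (2 * d) s with hlt | hle
  · exact .cond_true (by simpa [Test.Holds, ← hτ, h2, h6])
      (.op (o := .ncopy 6 2) trivial (by simp [Instr.det, ← hτ, h2, h3, hlt.le]))
  · exact .cond_false (by simpa [Test.Holds, ← hτ, h2, h6])
      (.skip (by simp [← hτ, h3, h6, hle]))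

/-- Initialize the sampler with the set of all columns. -/
def setupProg : Prog :=
  .seq initProg (.seq gramProg (.seq ridgeProg thresholdProg))

theorem ensures_setupProg (hd : 0 < d) (hl : 0 ≤ lam) (hrank : 0 < lam ∨ X.rank = d) :
    Ensures setupProg (input X lam s) (200 * ((n + d) * d ^ 2))
      (Stores X lam s Finset.univ) := by
  have hd2 : 1 ≤ d ^ 2 := Nat.one_le_pow _ _ hd
  refine ((ensures_initProg X lam s).seq fun τ ⟨hτ, hmatτ⟩ =>
    ((ensures_gramProg hτ hd hmatτ).frame (D := loadRegion) (by simp [Prog.Preserves,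
      Instr.Preserves, gramProg, rankOnesProg, rankOneProg, quadProg, mulColProg, colDotProg,
      dotProg, updateProg, forProg, block, loadRegion])).seq fun υ ⟨hτυ, hmatυ⟩ =>
    ((ensures_ridgeProg (hτ.agree hτυ) hd hl hrank hmatυ).frame (D := loadRegion)
      (by simp [Prog.Preserves, Instr.Preserves, ridgeProg, rankOnesProg, rankOneProg, quadProg,
      mulColProg, colDotProg, dotProg, updateProg, forProg, block, loadRegion])).seq
      fun ω ⟨hυω, hmatω⟩ => ((ensures_thresholdProg ((hτ.agree hτυ).agree hυω)).frame
        (D := ⟨{0, 1, 2, 4, 5}, {0, 1}, {0}, {0, 1}⟩)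
        (by simp [Prog.Preserves, Instr.Preserves, thresholdProg, block])).mono le_rfl
          fun ρ ⟨hωρ, hcard, hthr⟩ => ?_).mono (by nlinarith) fun _ => id
  have hρ : Loaded X lam s ρ := ((hτ.agree hτυ).agree hυω).agree
    ⟨hωρ.nreg, hωρ.rreg, hωρ.narr, fun A hA => hωρ.rarr A (.inl hA)⟩
  exact {
    toConsts := hρ.toConsts
    target := hρ.size
    card := by rw [hcard, Finset.card_fin]
    threshold := hthr
    rone := hρ.rone
    lists := hρ.lists
    cols := hρ.cols
    mat := by
      rw [← hmatω]
      ext a b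
      simp [matOf, hωρ.rarr] }

/-! ## The sampler -/

/-- Rejection sampling until at most `max s (2 * d)` columns are left, then exact sampling. -/
def sampleProg : Prog :=
  .seq setupProg (.seq rejectProg (.seq scoreProg exactProg))

theorem le_contProb_exactPhase {f : Finset (Fin n) → ℝ} {Q : State → Prop} {S : Finset (Fin n)}
    (hd : 0 < d) (hl : 0 ≤ lam) (hds : 0 < lam ∨ d ≤ s)
    (hQ : ∀ S σ, Stores X lam s S σ → S.card = s → f S ≤ contProb Q 0 [] σ)
    (hS : (regGram X lam S).PosDef) (h : Stores X lam s S σ) (hs : s ≤ S.card)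
    (hcard : S.card ≤ max s (2 * d)) :
    expectAfter X lam f (S.card - s) S ≤
      contProb Q (700 * ((n + d) * d ^ 2)) [.seq scoreProg exactProg] σ := by
  have hd2 : 1 ≤ d ^ 2 := Nat.one_le_pow _ _ hd
  have hSn : S.card ≤ n := card_finset_fin_le S
  have hremove : S.card - s ≤ 2 * d := by omega
  have hscore : S.card * (60 * d ^ 2 + 5) ≤ 65 * (n * d ^ 2) :=
    (Nat.mul_le_mul hSn (by omega)).trans_eq (Nat.mul_left_comm n 65 _)
  have hexact : (S.card - s) * (300 * d ^ 2 + 1) ≤ 602 * (d * d ^ 2) :=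
    (Nat.mul_le_mul hremove (by omega : 300 * d ^ 2 + 1 ≤ 301 * d ^ 2)).trans_eq (by ring)
  have hdd : d ^ 2 ≤ d * d ^ 2 := Nat.le_mul_of_pos_left _ hd
  calc expectAfter X lam f (S.card - s) S
    _ ≤ contProb Q (1 + (S.card - s) * (300 * d ^ 2 + 1) + (S.card * (60 * d ^ 2 + 5) + 3))
          (scoreProg :: [exactProg]) σ :=
        (ensures_scoreProg h hd hS).le_contProb fun τ ⟨hτ, hg⟩ =>
          le_contProb_exactProg hd hl hds hQ _ hS hτ hg (by omega) hcard
    _ = contProb Q (1 + (S.card - s) * (300 * d ^ 2 + 1) + (S.card * (60 * d ^ 2 + 5) + 3) + 1)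
          [.seq scoreProg exactProg] σ := (contProb_seq _ _ _ _ _).symm
    _ ≤ _ := contProb_mono _ _ (by rw [add_mul]; omega)

theorem le_contProb_sampleProg {f : Finset (Fin n) → ℝ} {Q : State → Prop} (hd : 0 < d)
    (hs : s ≤ n) (hl : 0 ≤ lam) (hds : 0 < lam ∨ d ≤ s) (hrank : 0 < lam ∨ X.rank = d)
    (hf : ∀ T, f T ≤ 1)
    (hQ : ∀ S σ, Stores X lam s S σ → S.card = s → f S ≤ contProb Q 0 [] σ) (r : ℕ) :
    expectAfter X lam f (n - s) Finset.univ - rejectLoss d s r (Finset.univ : Finset (Fin n)) ≤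
      contProb Q (1000 * ((n + d) * d ^ 2) + r * (161 * d ^ 2)) [sampleProg] (input X lam s) := by
  have hpos : 1 ≤ (n + d) * d ^ 2 := Nat.one_le_iff_ne_zero.2 (by positivity)
  have hreject := fun τ hτ => le_contProb_rejectProg (σ := τ) hd hl hf
    (fun S σ hS h hsS hle => le_contProb_exactPhase hd hl hds hQ hS h hsS hle) r
    (posDef_regGram_univ hl hrank) hτ (by simpa using hs)
  rw [Finset.card_fin] at hreject
  calc _
    _ ≤ contProb Q (700 * ((n + d) * d ^ 2) + 1 + r * (161 * d ^ 2) + 1 +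
          200 * ((n + d) * d ^ 2)) [setupProg, .seq rejectProg (.seq scoreProg exactProg)]
          (input X lam s) :=
        (ensures_setupProg hd hl hrank).le_contProb fun τ hτ =>
          (hreject τ hτ).trans_eq (contProb_seq _ _ _ _ _).symm
    _ = contProb Q (700 * ((n + d) * d ^ 2) + 1 + r * (161 * d ^ 2) + 1 +
          200 * ((n + d) * d ^ 2) + 1) [sampleProg] (input X lam s) :=
        (contProb_seq _ _ _ _ _).symm
    _ ≤ _ := contProb_mono _ _ (by omega)

/-! ## The law of the output and the running time -/

theorem haltProb_mono (p : Prog) (σ : State) (Q : State → Prop) :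
    Monotone fun t => haltProb p σ t Q :=
  toOuterMeasure_run_mono ([p], σ)

theorem sum_haltProb_le_one (p : Prog) (σ : State) (t n s : ℕ) :
    ∑ T : Finset (Fin n), haltProb p σ t (fun τ => output n s τ = T) ≤ 1 := by
  simp only [haltProb, PMF.toOuterMeasure_apply]
  rw [← Summable.tsum_finsetSum fun _ _ => ENNReal.summable, ← (run t ([p], σ)).tsum_coe]
  refine ENNReal.tsum_le_tsum fun c => ?_
  rw [Finset.sum_eq_single (output n s c.2)]
  · exact Set.indicator_le_self _ _ _
  · intro T _ hT
    exact Set.indicator_of_notMem (fun h => hT h.2.symm) _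
  · simp

theorem sum_iSup_haltProb_le_one (p : Prog) (σ : State) (n s : ℕ) :
    ∑ T : Finset (Fin n), ⨆ t, haltProb p σ t (fun τ => output n s τ = T) ≤ 1 := by
  rw [ENNReal.finsetSum_iSup_of_monotone fun T => haltProb_mono p σ _]
  exact iSup_le fun t => sum_haltProb_le_one p σ t n s

theorem eq_ofReal_of_sum_le_one {ι : Type*} [Fintype ι] {a : ι → ENNReal} {x : ι → ℝ}
    (ha : ∑ i, a i ≤ 1) (hx : ∑ i, x i = 1) (h : ∀ i, ENNReal.ofReal (x i) ≤ a i) (i : ι) :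
    a i = ENNReal.ofReal (x i) := by
  have hfin (i : ι) : a i ≠ ⊤ :=
    ENNReal.sum_ne_top.1 (ne_top_of_le_ne_top ENNReal.one_ne_top ha) i (Finset.mem_univ i)
  have hle (i : ι) : x i ≤ (a i).toReal := (ENNReal.ofReal_le_iff_le_toReal (hfin i)).1 (h i)
  have hsum : ∑ i, (a i).toReal ≤ ∑ i, x i := by
    rw [hx, ← ENNReal.toReal_sum fun i _ => hfin i]
    exact ENNReal.toReal_le_of_le_ofReal zero_le_one (by simpa using ha)
  have heq := (Finset.sum_eq_sum_iff_of_le fun i _ => hle i).1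
    ((Finset.sum_le_sum fun i _ => hle i).antisymm hsum) i (Finset.mem_univ i)
  rw [heq, ENNReal.ofReal_toReal (hfin i)]

theorem two_pow_mul_le {n r : ℕ} {δ : ℝ} (hδ : 0 < δ)
    (hr : 4 * n + 4 * Real.log (1 / δ) ≤ (r : ℝ)) : 2 ^ n * (3 / 4 : ℝ) ^ r ≤ δ := by
  have h2 : (2 : ℝ) ≤ Real.exp 1 := by linarith [Real.add_one_le_exp (1 : ℝ)]
  have h34 : (3 / 4 : ℝ) ≤ Real.exp (-(1 / 4)) := by linarith [Real.add_one_le_exp (-(1 / 4) : ℝ)]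
  rw [one_div, Real.log_inv] at hr
  calc 2 ^ n * (3 / 4 : ℝ) ^ r ≤ Real.exp 1 ^ n * Real.exp (-(1 / 4)) ^ r := by gcongr
    _ = Real.exp (n - r / 4) := by
        rw [← Real.exp_nat_mul, ← Real.exp_nat_mul, ← Real.exp_add]
        congr 1
        ring
    _ ≤ Real.exp (Real.log δ) := Real.exp_le_exp.2 (by linarith)
    _ = δ := Real.exp_log hδ

theorem rejectLoss_univ_le (d s : ℕ) {n r : ℕ} {δ : ℝ} (hδ : 0 < δ)
    (hr : 4 * n + 4 * Real.log (1 / δ) ≤ (r : ℝ)) :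
    rejectLoss d s r (Finset.univ : Finset (Fin n)) ≤ δ := by
  rw [rejectLoss, Finset.card_fin]
  split_ifs
  · exact hδ.le
  · exact two_pow_mul_le hδ hr

theorem regVolProb_sub_le_haltProb (hd : 0 < d) (hs : s ≤ n) (hl : 0 ≤ lam)
    (hds : 0 < lam ∨ d ≤ s) (hrank : 0 < lam ∨ X.rank = d) (T : Finset (Fin n)) (r : ℕ) :
    ENNReal.ofReal (regVolProb X lam s T - rejectLoss d s r (Finset.univ : Finset (Fin n))) ≤
      haltProb sampleProg (input X lam s) (1000 * ((n + d) * d ^ 2) + r * (161 * d ^ 2))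
        (fun σ => output n s σ = T) := by
  rw [haltProb_eq_ofReal_contProb, regVolProb, ← expectAfter_univ_single]
  refine ENNReal.ofReal_le_ofReal (le_contProb_sampleProg hd hs hl hds hrank
    (fun S => ?_) (fun S σ h hS => ?_) r)
  · rw [Pi.single_apply]
    split_ifs <;> norm_num
  · rw [Pi.single_apply]
    split_ifs with hST
    · exact (contProb_nil ((h.output hS).trans hST) 0).ge
    · exact contProb_nonneg _ _ _

theorem iSup_haltProb_sampleProg (hd : 0 < d) (hs : s ≤ n) (hl : 0 ≤ lam)
    (hds : 0 < lam ∨ d ≤ s) (hrank : 0 < lam ∨ X.rank = d) (T : Finset (Fin n)) :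
    ⨆ t, haltProb sampleProg (input X lam s) t (fun σ => output n s σ = T) =
      ENNReal.ofReal (regVolProb X lam s T) := by
  refine eq_ofReal_of_sum_le_one (sum_iSup_haltProb_le_one _ _ _ _)
    (sum_regVolProb hs hl hds hrank) (fun T => ?_) T
  refine ENNReal.le_of_forall_pos_le_add fun ε hε _ => ?_
  obtain ⟨r, hr⟩ := exists_nat_ge (4 * n + 4 * Real.log (1 / ε))
  calc ENNReal.ofReal (regVolProb X lam s T)
    _ ≤ ENNReal.ofReal (regVolProb X lam s T - rejectLoss d s r Finset.univ + ε) :=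
        ENNReal.ofReal_le_ofReal
          (by linarith [rejectLoss_univ_le d s (NNReal.coe_pos.2 hε) hr])
    _ ≤ ENNReal.ofReal (regVolProb X lam s T - rejectLoss d s r Finset.univ) + ε :=
        ENNReal.ofReal_add_le.trans_eq (by rw [ENNReal.ofReal_coe_nnreal])
    _ ≤ _ := by
        gcongr
        exact (regVolProb_sub_le_haltProb hd hs hl hds hrank T r).trans
          (le_iSup (fun t => haltProb sampleProg (input X lam s) t fun σ => output n s σ = T) _)

theorem one_sub_rejectLoss_le_haltProb (hd : 0 < d) (hs : s ≤ n) (hl : 0 ≤ lam)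
    (hds : 0 < lam ∨ d ≤ s) (hrank : 0 < lam ∨ X.rank = d) (r : ℕ) :
    ENNReal.ofReal (1 - rejectLoss d s r (Finset.univ : Finset (Fin n))) ≤
      haltProb sampleProg (input X lam s) (1000 * ((n + d) * d ^ 2) + r * (161 * d ^ 2))
        (fun _ => True) := by
  rw [haltProb_eq_ofReal_contProb, ← expectAfter_one (s := s) hl hds (n - s)
    (posDef_regGram_univ hl hrank) (by simp; omega)]
  exact ENNReal.ofReal_le_ofReal (le_contProb_sampleProg hd hs hl hds hrank (fun _ => le_rfl)
    (fun _ _ _ _ => (contProb_nil trivial 0).ge) r)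

theorem half_le_log_div (hd : 0 < d) (hnd : 2 * d ≤ n) : 1 / 2 ≤ Real.log (n / d) := by
  have hd0 : (0 : ℝ) < d := by exact_mod_cast hd
  calc (1 / 2 : ℝ) ≤ Real.log 2 := by linarith [Real.log_two_gt_d9]
    _ ≤ Real.log (n / d) :=
        Real.log_le_log (by norm_num) ((le_div_iff₀ hd0).2 (by exact_mod_cast hnd))

theorem exists_rejectLoss_le (hd : 0 < d) (n s : ℕ) {δ : ℝ} (hδ : 0 < δ) (hδ1 : δ ≤ 1) :
    ∃ r : ℕ, rejectLoss d s r (Finset.univ : Finset (Fin n)) ≤ δ ∧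
      1000 * (n + d : ℝ) + 161 * r ≤
        3000 * (n + d + max 0 (Real.log (n / d)) * Real.log (1 / δ)) := by
  set L := Real.log (1 / δ)
  set M := max 0 (Real.log (n / d))
  have hL : 0 ≤ L := Real.log_nonneg ((one_le_div hδ).2 hδ1)
  have hML : 0 ≤ M * L := mul_nonneg (le_max_left _ _) hL
  have hd1 : (1 : ℝ) ≤ d := by exact_mod_cast hd
  by_cases hn : n ≤ max s (2 * d)
  · refine ⟨0, ?_, ?_⟩
    · rw [rejectLoss, Finset.card_fin, if_pos hn]
      exact hδ.le
    · rw [Nat.cast_zero]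
      linarith
  · have hM : 1 / 2 ≤ M := (half_le_log_div hd (by omega)).trans (le_max_right _ _)
    have hLM : L ≤ 2 * (M * L) := by linarith [mul_le_mul_of_nonneg_right hM hL]
    refine ⟨⌈4 * n + 4 * L⌉₊, rejectLoss_univ_le d s hδ (Nat.le_ceil _), ?_⟩
    linarith [Nat.ceil_lt_add_one (show 0 ≤ 4 * n + 4 * L by positivity)]

theorem le_haltProb_sampleProg (hd : 0 < d) (hs : s ≤ n) (hl : 0 ≤ lam)
    (hds : 0 < lam ∨ d ≤ s) (hrank : 0 < lam ∨ X.rank = d) {δ : ℝ} (hδ : 0 < δ) :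
    ENNReal.ofReal (1 - δ) ≤ haltProb sampleProg (input X lam s)
      ⌊3000 * ((n + d + max 0 (Real.log (n / d)) * Real.log (1 / δ)) * d ^ 2)⌋₊
      (fun _ => True) := by
  rcases le_or_gt 1 δ with h1 | h1
  · rw [ENNReal.ofReal_of_nonpos (by linarith)]
    exact zero_le
  obtain ⟨r, hloss, hbudget⟩ := exists_rejectLoss_le hd n s hδ h1.le
  have htime : 1000 * ((n + d) * d ^ 2) + r * (161 * d ^ 2) ≤
      ⌊3000 * ((n + d + max 0 (Real.log (n / d)) * Real.log (1 / δ)) * d ^ 2)⌋₊ := by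
    refine Nat.le_floor ?_
    push_cast
    linarith [mul_le_mul_of_nonneg_right hbudget (sq_nonneg (d : ℝ))]
  calc ENNReal.ofReal (1 - δ)
    _ ≤ ENNReal.ofReal (1 - rejectLoss d s r (Finset.univ : Finset (Fin n))) :=
        ENNReal.ofReal_le_ofReal (by linarith)
    _ ≤ haltProb sampleProg (input X lam s) (1000 * ((n + d) * d ^ 2) + r * (161 * d ^ 2))
          (fun _ => True) := one_sub_rejectLoss_le_haltProb hd hs hl hds hrank r
    _ ≤ _ := haltProb_mono _ _ _ htime

end RealRAM

theorem theorem4 :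
    ∃ (p : RealRAM.Prog) (C : ℝ), 0 < C ∧
      ∀ (d n s : ℕ) (X : Matrix (Fin d) (Fin n) ℝ) (lam : ℝ), 0 < d → s ≤ n →
        (0 < lam ∨ (lam = 0 ∧ X.rank = d ∧ d ≤ s)) →
        (∀ T : Finset (Fin n),
          (⨆ t : ℕ, RealRAM.haltProb p (RealRAM.input X lam s) t
              (fun σ => RealRAM.output n s σ = T)) =
            ENNReal.ofReal (VolumeSampling.regVolProb X lam s T)) ∧
        ∀ δ : ℝ, 0 < δ →
          ENNReal.ofReal (1 - δ) ≤
            RealRAM.haltProb p (RealRAM.input X lam s)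
              ⌊C * ((n + d + max 0 (Real.log (n / d)) * Real.log (1 / δ)) * d ^ 2)⌋₊
              (fun _ => True) := by
  refine ⟨RealRAM.sampleProg, 3000, by norm_num, fun d n s X lam hd hs hadm => ?_⟩
  have hl : 0 ≤ lam := hadm.elim le_of_lt fun h => h.1.ge
  have hds : 0 < lam ∨ d ≤ s := hadm.imp_right fun h => h.2.2
  have hrank : 0 < lam ∨ X.rank = d := hadm.imp_right fun h => h.2.1
  exact ⟨RealRAM.iSup_haltProb_sampleProg hd hs hl hds hrank,
    fun δ hδ => RealRAM.le_haltProb_sampleProg hd hs hl hds hrank hδ⟩
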